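/- Links are unoriented links in $S^3$, presented by link diagrams on the oriented sphere $S^2$ (two diagrams present isotopic links if and only if they are related by finitely many Reidemeister moves and orientation-preserving homeomorphisms of $S^2$). A $3$-move replaces, inside a disc in a link diagram, two parallel arcs without crossings by the same two strands twisted around each other by three half twists of the same sign (either sign). Two links are $3$-equivalent if one can be transformed into the other by a finite sequence of isotopies, $3$-moves and inverses of $3$-moves. Let $K$ be a knot (a link with exactly one component). If $K$ is $3$-equivalent to the unlink of $n$ components for some even $n$, then $K$ is chiral, i.e. $K$ is not isotopic to its mirror image (no matter how $K$ and its mirror image are oriented). -/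

import Mathlib

/-!
Unoriented link diagrams on the oriented sphere, as combinatorial maps of genus zero.

A link in the 3-sphere is given by a diagram, two diagrams give isotopic links if and only if they
are related by Reidemeister moves, and a local move replaces a diagram inside a disc.
-/

/-- The darts (half-edges) of a diagram with crossings `X`, marked points `P` and `k` ends.
The darts `cross x 0, cross x 1, cross x 2, cross x 3` leave the crossing `x` in this
counterclockwise order; the darts `0, 2` belong to the strand passing under,
the darts `1, 3` to the strand passing over.
A marked point is an auxiliary two-valent vertex on a strand, with one dart on each side
(it allows for components without crossings).  `tip i` is the `i`-th end of a tangle. -/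
inductive Dart (X P : Type) (k : ℕ) : Type
  | cross (x : X) (s : Fin 4)
  | mark (p : P) (b : Bool)
  | tip (i : Fin k)
  deriving DecidableEq

namespace Dart

/-- Darts as a disjoint union. -/
def equivSum (X P : Type) (k : ℕ) : (X × Fin 4) ⊕ (P × Bool) ⊕ Fin k ≃ Dart X P k where
  toFun := Sum.elim (fun a => cross a.1 a.2) (Sum.elim (fun a => mark a.1 a.2) tip)
  invFun
    | cross x s => Sum.inl (x, s)
    | mark p b => Sum.inr (Sum.inl (p, b))
    | tip i => Sum.inr (Sum.inr i)
  left_inv := by rintro (⟨x, s⟩ | ⟨p, b⟩ | i) <;> rfl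
  right_inv := by rintro (_ | _ | _) <;> rfl

instance {X P : Type} {k : ℕ} [Fintype X] [Fintype P] : Fintype (Dart X P k) :=
  Fintype.ofEquiv _ (equivSum X P k)

instance {X P : Type} {k : ℕ} [Finite X] [Finite P] : Finite (Dart X P k) :=
  Finite.of_equiv _ (equivSum X P k)

/-- The next dart at the same vertex in counterclockwise order.  The ends of a tangle are listed
counterclockwise along the boundary circle of its disc; collapsing the complementary disc
of the sphere to one vertex, they appear around that vertex in the opposite order. -/
def rot {X P : Type} {k : ℕ} : Dart X P k → Dart X P k
  | cross x s => cross x (s + 1)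
  | mark p b => mark p (!b)
  | tip i => tip ((finRotate k).symm i)

/-- Passing straight through a crossing or a marked point (ends are left unchanged). -/
def straight {X P : Type} {k : ℕ} : Dart X P k → Dart X P k
  | cross x s => cross x (s + 2)
  | mark p b => mark p (!b)
  | tip i => tip i

/-- The dart belongs to the strand passing over at a crossing. -/
def IsOver {X P : Type} {k : ℕ} : Dart X P k → Prop
  | cross _ s => s = 1 ∨ s = 3
  | mark _ _ => False
  | tip _ => False

/-- Rotation of the labels of all four darts at every crossing by one step. -/
def shift {X P : Type} {k : ℕ} : Dart X P k ≃ Dart X P k where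
  toFun
    | cross x s => cross x (s + 1)
    | mark p b => mark p b
    | tip i => tip i
  invFun
    | cross x s => cross x (s - 1)
    | mark p b => mark p b
    | tip i => tip i
  left_inv := by rintro (_ | _ | _) <;> simp
  right_inv := by rintro (_ | _ | _) <;> simp

/-- The darts of a diagram, seen in the diagram with one more marked point. -/
def lift {X P : Type} {k : ℕ} : Dart X P k → Dart X (Option P) k
  | cross x s => cross x s
  | mark p b => mark (some p) b
  | tip i => tip i

theorem lift_injective {X P : Type} {k : ℕ} :
    Function.Injective (lift : Dart X P k → Dart X (Option P) k) := by
  rintro (_ | _ | _) (_ | _ | _) h <;> simp_all [lift]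

/-- The darts of the left tangle, seen in the union of two tangles glued along their boundary
circles; the `i`-th boundary point becomes a marked point. -/
def inLeft {X P Y Q : Type} {k : ℕ} : Dart X P k → Dart (X ⊕ Y) ((P ⊕ Q) ⊕ Fin k) 0
  | cross x s => cross (Sum.inl x) s
  | mark p b => mark (Sum.inl (Sum.inl p)) b
  | tip i => mark (Sum.inr i) false

/-- The darts of the right tangle, seen in the union of two tangles glued along their boundary
circles.  The two discs induce opposite orders on the common boundary circle. -/
def inRight {X P Y Q : Type} {k : ℕ} : Dart Y Q k → Dart (X ⊕ Y) ((P ⊕ Q) ⊕ Fin k) 0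
  | cross y s => cross (Sum.inr y) s
  | mark q b => mark (Sum.inl (Sum.inr q)) b
  | tip i => mark (Sum.inr i.rev) true

end Dart

open Dart

/-- A tangle diagram with `k` ends, listed counterclockwise along the boundary circle of its disc:
finitely many crossings and marked points, and an involution `edge` without fixed points that
joins each dart to the other half of its edge. -/
structure Tangle (k : ℕ) : Type 1 where
  X : Type
  P : Type
  finX : Finite X
  finP : Finite P
  edge : Dart X P k → Dart X P k
  edge_edge : ∀ d, edge (edge d) = d
  edge_ne : ∀ d, edge d ≠ d

namespace Tangle

attribute [instance] Tangle.finX Tangle.finP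

abbrev D {k : ℕ} (T : Tangle k) : Type := Dart T.X T.P k

/-- Vertices of the map; if `k > 0`, the complementary disc of a tangle counts as one vertex. -/
abbrev Vertices {k : ℕ} (T : Tangle k) : Type := Quot fun d e : T.D => e = rot d

abbrev Edges {k : ℕ} (T : Tangle k) : Type := Quot fun d e : T.D => e = T.edge d

/-- Faces, through their boundary walks. -/
abbrev Faces {k : ℕ} (T : Tangle k) : Type := Quot fun d e : T.D => e = rot (T.edge d)

/-- Connected components of the underlying graph. -/
abbrev Pieces {k : ℕ} (T : Tangle k) : Type := Quot fun d e : T.D => e = rot d ∨ e = T.edge d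

/-- The strands of a diagram, and for `k = 0` the components of the link. -/
abbrev Strands {k : ℕ} (T : Tangle k) : Type :=
  Quot fun d e : T.D => e = straight d ∨ e = T.edge d

/-- Each connected component of the map has genus zero (Euler's formula, summed over the
components). -/
def IsPlanar {k : ℕ} (T : Tangle k) : Prop :=
  Nat.card T.Vertices + Nat.card T.Faces = Nat.card T.Edges + 2 * Nat.card T.Pieces

/-- Isomorphism of diagrams: an orientation preserving isomorphism of maps that respects
over- and underpasses and fixes the ends. -/
def Iso {k : ℕ} (S T : Tangle k) : Prop :=
  ∃ f : S.D ≃ T.D, (∀ d, f (rot d) = rot (f d)) ∧ (∀ d, f (S.edge d) = T.edge (f d)) ∧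
    (∀ d, (f d).IsOver ↔ d.IsOver) ∧ ∀ i, f (tip i) = tip i

open Classical in
/-- The new edges when a marked point is put on the edge of `d`, at a dart of the old diagram. -/
noncomputable def cut {k : ℕ} (T : Tangle k) (d e : T.D) : Dart T.X (Option T.P) k :=
  if e = d then mark none false else if e = T.edge d then mark none true else lift (T.edge e)

/-- The new edges when a marked point is put on the edge of `d`. -/
noncomputable def subdivideEdge {k : ℕ} (T : Tangle k) (d : T.D) :
    Dart T.X (Option T.P) k → Dart T.X (Option T.P) k
  | cross x s => T.cut d (cross x s)
  | mark (some p) b => T.cut d (mark p b)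
  | tip i => T.cut d (tip i)
  | mark none false => lift d
  | mark none true => lift (T.edge d)

theorem subdivideEdge_lift {k : ℕ} (T : Tangle k) (d e : T.D) :
    T.subdivideEdge d (lift e) = T.cut d e := by
  cases e <;> rfl

/-- Put a marked point on the edge of the dart `d`. -/
noncomputable def subdivide {k : ℕ} (T : Tangle k) (d : T.D) : Tangle k where
  X := T.X
  P := Option T.P
  finX := inferInstance
  finP := inferInstance
  edge := T.subdivideEdge d
  edge_edge := by
    have hd := T.edge_ne d
    have key : ∀ e, T.subdivideEdge d (T.cut d e) = lift e := by
      intro e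
      by_cases h1 : e = d
      · subst h1; simp [cut, subdivideEdge]
      by_cases h2 : e = T.edge d
      · subst h2; simp [cut, subdivideEdge, hd]
      have h3 : T.edge e ≠ d := fun h => h2 (by rw [← h, T.edge_edge])
      have h4 : T.edge e ≠ T.edge d := fun h => h1 (by rw [← T.edge_edge e, h, T.edge_edge])
      simp [cut, h1, h2, subdivideEdge_lift, h3, h4, T.edge_edge]
    rintro (⟨x, s⟩ | ⟨_ | p, b⟩ | i)
    · exact key (cross x s)
    · cases b
      · change T.subdivideEdge d (lift d) = _
        simp [subdivideEdge_lift, cut]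
      · change T.subdivideEdge d (lift (T.edge d)) = _
        simp [subdivideEdge_lift, cut, hd]
    · exact key (mark p b)
    · exact key (tip i)
  edge_ne := by
    have key : ∀ e, T.cut d e ≠ lift e := by
      intro e
      unfold cut
      split_ifs
      · cases e <;> simp [lift]
      · cases e <;> simp [lift]
      · exact fun h => T.edge_ne e (lift_injective h)
    have key2 : ∀ (e : T.D) (b : Bool), lift e ≠ mark none b := by
      intro e b; cases e <;> simp [lift]
    rintro (⟨x, s⟩ | ⟨_ | p, b⟩ | i)
    · exact key (cross x s)
    · cases b
      · exact key2 _ _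
      · exact key2 _ _
    · exact key (mark p b)
    · exact key (tip i)

/-- The edges of two tangles glued along their boundary circles. -/
def glueEdge {k : ℕ} (S T : Tangle k) :
    Dart (S.X ⊕ T.X) ((S.P ⊕ T.P) ⊕ Fin k) 0 → Dart (S.X ⊕ T.X) ((S.P ⊕ T.P) ⊕ Fin k) 0
  | cross (Sum.inl x) s => inLeft (S.edge (cross x s))
  | cross (Sum.inr y) s => inRight (T.edge (cross y s))
  | mark (Sum.inl (Sum.inl p)) b => inLeft (S.edge (mark p b))
  | mark (Sum.inl (Sum.inr q)) b => inRight (T.edge (mark q b))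
  | mark (Sum.inr i) false => inLeft (S.edge (tip i))
  | mark (Sum.inr i) true => inRight (T.edge (tip i.rev))

theorem glueEdge_inLeft {k : ℕ} (S T : Tangle k) (d : S.D) :
    glueEdge S T (inLeft d) = inLeft (S.edge d) := by
  cases d <;> rfl

theorem glueEdge_inRight {k : ℕ} (S T : Tangle k) (d : T.D) :
    glueEdge S T (inRight d) = inRight (T.edge d) := by
  cases d <;> simp [inRight, glueEdge]

theorem glue_cases {k : ℕ} (S T : Tangle k) (d : Dart (S.X ⊕ T.X) ((S.P ⊕ T.P) ⊕ Fin k) 0) :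
    (∃ e : S.D, d = inLeft e) ∨ ∃ e : T.D, d = inRight e := by
  rcases d with ⟨x | y, s⟩ | ⟨(p | q) | i, b⟩ | i
  · exact Or.inl ⟨cross x s, rfl⟩
  · exact Or.inr ⟨cross y s, rfl⟩
  · exact Or.inl ⟨mark p b, rfl⟩
  · exact Or.inr ⟨mark q b, rfl⟩
  · cases b
    · exact Or.inl ⟨tip i, rfl⟩
    · exact Or.inr ⟨tip i.rev, by simp [inRight]⟩
  · exact i.elim0

theorem inLeft_injective {X P Y Q : Type} {k : ℕ} :
    Function.Injective (inLeft : Dart X P k → Dart (X ⊕ Y) ((P ⊕ Q) ⊕ Fin k) 0) := by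
  rintro (_ | _ | _) (_ | _ | _) h <;> simp_all [inLeft]

theorem inRight_injective {X P Y Q : Type} {k : ℕ} :
    Function.Injective (inRight : Dart Y Q k → Dart (X ⊕ Y) ((P ⊕ Q) ⊕ Fin k) 0) := by
  rintro (_ | _ | _) (_ | _ | _) h <;> simp_all [inRight]

/-- The closed diagram on the sphere obtained from tangles in two complementary discs. -/
def glue {k : ℕ} (S T : Tangle k) : Tangle 0 where
  X := S.X ⊕ T.X
  P := (S.P ⊕ T.P) ⊕ Fin k
  finX := inferInstance
  finP := inferInstance
  edge := glueEdge S T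
  edge_edge := by
    intro d
    rcases glue_cases S T d with ⟨e, rfl⟩ | ⟨e, rfl⟩
    · simp [glueEdge_inLeft, S.edge_edge]
    · simp [glueEdge_inRight, T.edge_edge]
  edge_ne := by
    intro d
    rcases glue_cases S T d with ⟨e, rfl⟩ | ⟨e, rfl⟩
    · rw [glueEdge_inLeft]; exact fun h => S.edge_ne e (inLeft_injective h)
    · rw [glueEdge_inRight]; exact fun h => T.edge_ne e (inRight_injective h)

/-- The other entry of the first pair that contains `d`. -/
def partner {α : Type} [DecidableEq α] : List (α × α) → α → α
  | [], d => d
  | (a, b) :: l, d => if d = a then b else if d = b then a else partner l d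

/-- The tangle with `n` crossings, `k` ends and the listed edges. -/
def ofPairs (n k : ℕ) (l : List (Dart (Fin n) Empty k × Dart (Fin n) Empty k))
    (h : ∀ d, partner l (partner l d) = d ∧ partner l d ≠ d) : Tangle k where
  X := Fin n
  P := Empty
  finX := inferInstance
  finP := inferInstance
  edge := partner l
  edge_edge := fun d => (h d).1
  edge_ne := fun d => (h d).2

/-- The dart at the corner `c` of a crossing whose corners, in counterclockwise order,
are `0` (lower left), `1` (lower right), `2` (upper right), `3` (upper left).
If `a` is true, the strand from corner `0` to corner `2` is over, otherwise it is under. -/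
def corner {P : Type} {n k : ℕ} (a : Bool) (x : Fin n) (c : Fin 4) : Dart (Fin n) P k :=
  cross x (if a then c + 1 else c)

/-- A single arc. -/
def arc : Tangle 2 := ofPairs 0 2 [(tip 0, tip 1)] (by decide)

/-- A single arc with a kink, for each of the two types of crossing. -/
def kink (a : Bool) : Tangle 2 :=
  ofPairs 1 2 [(tip 0, corner a 0 0), (tip 1, corner a 0 1), (corner a 0 2, corner a 0 3)]
    (by revert a; decide)

/-- Two horizontal arcs, where the ends `0, 1, 2, 3` are at the lower left, lower right,
upper right and upper left. -/
def arcs : Tangle 4 := ofPairs 0 4 [(tip 0, tip 1), (tip 3, tip 2)] (by decide)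

/-- Two horizontal arcs, one pushed over the other: a row of two opposite half twists. -/
def pushed (a : Bool) : Tangle 4 :=
  ofPairs 2 4
    [(tip 0, corner a 0 0), (tip 3, corner a 0 3),
     (corner a 0 1, corner (!a) 1 0), (corner a 0 2, corner (!a) 1 3),
     (corner (!a) 1 1, tip 1), (corner (!a) 1 2, tip 2)]
    (by revert a; decide)

/-- Two horizontal strands twisted around each other by three half twists, of the same
type `a`. -/
def threeTwists (a : Bool) : Tangle 4 :=
  ofPairs 3 4
    [(tip 0, corner a 0 0), (tip 3, corner a 0 3),
     (corner a 0 1, corner a 1 0), (corner a 0 2, corner a 1 3),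
     (corner a 1 1, corner a 2 0), (corner a 1 2, corner a 2 3),
     (corner a 2 1, tip 1), (corner a 2 2, tip 2)]
    (by revert a; decide)

set_option maxRecDepth 10000 in
/-- The ends `0, …, 5` are at the left, lower left, lower right, right, upper right, upper left.
The strand from `1` to `4` and the strand from `2` to `5` cross in the crossing `2` (the former is
over if `a` is true).  A horizontal strand from `0` to `3` passes below that point and over both
other strands, in the crossings `0` and `1`. -/
def overBelow (a : Bool) : Tangle 6 :=
  ofPairs 3 6
    [(tip 0, cross 0 1), (cross 0 3, cross 1 1), (cross 1 3, tip 3),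
     (tip 1, cross 0 2), (cross 0 0, corner a 2 0), (corner a 2 2, tip 4),
     (tip 2, cross 1 2), (cross 1 0, corner a 2 1), (corner a 2 3, tip 5)]
    (by revert a; decide)

set_option maxRecDepth 10000 in
/-- As `overBelow`, but the horizontal strand passes above the crossing of the two others. -/
def overAbove (a : Bool) : Tangle 6 :=
  ofPairs 3 6
    [(tip 0, cross 1 1), (cross 1 3, cross 0 1), (cross 0 3, tip 3),
     (tip 1, corner a 2 0), (corner a 2 2, cross 0 2), (cross 0 0, tip 4),
     (tip 2, corner a 2 1), (corner a 2 3, cross 1 2), (cross 1 0, tip 5)]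
    (by revert a; decide)

/-- Exchange of over and under at every crossing. -/
def mirror {k : ℕ} (T : Tangle k) : Tangle k where
  X := T.X
  P := T.P
  finX := inferInstance
  finP := inferInstance
  edge := fun d => shift.symm (T.edge (shift d))
  edge_edge := by intro d; simp [T.edge_edge]
  edge_ne := by
    intro d h
    exact T.edge_ne (shift d) ((Equiv.symm_apply_eq shift).1 h)

theorem shift_rot {X P : Type} {k : ℕ} (d : Dart X P k) : shift (rot d) = rot (shift d) := by
  cases d <;> rfl

theorem IsPlanar.mirror {k : ℕ} {T : Tangle k} (hT : T.IsPlanar) : T.mirror.IsPlanar := by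
  have hr : ∀ d e : Dart T.X T.P k, e = rot d ↔ shift e = rot (shift d) := by
    intro d e; rw [← shift_rot, shift.injective.eq_iff]
  have he : ∀ d e : Dart T.X T.P k, e = T.mirror.edge d ↔ shift e = T.edge (shift d) := by
    intro d e; exact Equiv.eq_symm_apply shift
  have hf : ∀ d e : Dart T.X T.P k,
      e = rot (T.mirror.edge d) ↔ shift e = rot (T.edge (shift d)) := by
    intro d e
    refine (hr (shift.symm (T.edge (shift d))) e).trans ?_
    rw [Equiv.apply_symm_apply]
  have h1 : Nat.card T.mirror.Vertices = Nat.card T.Vertices :=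
    Nat.card_congr (Quot.congr shift hr)
  have h2 : Nat.card T.mirror.Edges = Nat.card T.Edges :=
    Nat.card_congr (Quot.congr shift he)
  have h3 : Nat.card T.mirror.Faces = Nat.card T.Faces :=
    Nat.card_congr (Quot.congr shift hf)
  have h4 : Nat.card T.mirror.Pieces = Nat.card T.Pieces :=
    Nat.card_congr (Quot.congr shift fun d e => or_congr (hr d e) (he d e))
  unfold IsPlanar at *
  rw [h1, h2, h3, h4, hT]

/-- `n` disjoint circles. -/
def circles (n : ℕ) : Tangle 0 where
  X := Empty
  P := Fin n
  finX := inferInstance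
  finP := inferInstance
  edge := rot
  edge_edge := by
    rintro (x | ⟨p, b⟩ | i)
    · exact x.elim
    · simp [rot]
    · exact i.elim0
  edge_ne := by
    rintro (x | ⟨p, b⟩ | i)
    · exact x.elim
    · simp [rot]
    · exact i.elim0

theorem circles_isPlanar (n : ℕ) : (circles n).IsPlanar := by
  have hrr : ∀ d : (circles n).D, rot ((circles n).edge d) = d := (circles n).edge_edge
  have e0 : (circles n).D ≃ Fin n × Bool :=
    { toFun := fun d => match d with
        | mark p b => (p, b)
      invFun := fun a => mark a.1 a.2
      left_inv := by
        rintro (x | ⟨p, b⟩ | i)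
        · exact x.elim
        · rfl
        · exact i.elim0
      right_inv := fun _ => rfl }
  have hF : Nat.card (circles n).Faces = n * 2 := by
    have e : (circles n).Faces ≃ (circles n).D :=
      { toFun := Quot.lift id fun d e h => by rw [h, hrr]
        invFun := Quot.mk _
        left_inv := by rintro ⟨d⟩; rfl
        right_inv := fun _ => rfl }
    rw [Nat.card_congr e, Nat.card_congr e0]; simp
  have hV : Nat.card (circles n).Vertices = n := by
    have e : (circles n).Vertices ≃ Fin n :=
      { toFun := Quot.lift (fun d => match d with
          | mark p _ => p) (by
            rintro (x | ⟨p, b⟩ | i) _ rfl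
            · exact x.elim
            · rfl
            · exact i.elim0)
        invFun := fun p => Quot.mk _ (mark p false)
        left_inv := by
          rintro ⟨x | ⟨p, b⟩ | i⟩
          · exact x.elim
          · cases b
            · rfl
            · exact Quot.sound rfl
          · exact i.elim0
        right_inv := fun _ => rfl }
    rw [Nat.card_congr e]; simp
  have hP : Nat.card (circles n).Pieces = Nat.card (circles n).Vertices :=
    Nat.card_congr (Quot.congr (Equiv.refl _) fun d e => by
      change (e = rot d ∨ e = rot d) ↔ _; simp)
  have hE : Nat.card (circles n).Edges = Nat.card (circles n).Vertices := rfl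
  unfold IsPlanar
  rw [hP, hE, hF, hV]; ring

end Tangle

/-- A link diagram on the sphere. -/
structure LinkDiagram extends Tangle 0 where
  planar : toTangle.IsPlanar

namespace LinkDiagram

/-- The link has exactly one component. -/
def IsKnot (K : LinkDiagram) : Prop := Nat.card K.Strands = 1

/-- The diagram of the mirror image. -/
def mirror (K : LinkDiagram) : LinkDiagram := ⟨K.toTangle.mirror, K.planar.mirror⟩

/-- The unlink of `n` components. -/
def unlink (n : ℕ) : LinkDiagram := ⟨Tangle.circles n, Tangle.circles_isPlanar n⟩

/-- `E` arises from `D` by replacing the tangle `T` in some disc by `U`, while the tangle `S` in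
the complementary disc is kept. -/
def LocalMove {k : ℕ} (T U : Tangle k) (D E : LinkDiagram) : Prop :=
  ∃ S : Tangle k, S.IsPlanar ∧ D.toTangle.Iso (S.glue T) ∧ E.toTangle.Iso (S.glue U)

/-- The Reidemeister moves, together with isomorphisms of diagrams on the sphere and
the introduction of marked points. -/
inductive ReidemeisterMove : LinkDiagram → LinkDiagram → Prop
  | iso {D E : LinkDiagram} (h : D.toTangle.Iso E.toTangle) : ReidemeisterMove D E
  | subdivide {D E : LinkDiagram} (d : D.D) (h : E.toTangle.Iso (D.toTangle.subdivide d)) :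
      ReidemeisterMove D E
  | one {D E : LinkDiagram} (a : Bool) (h : LocalMove Tangle.arc (Tangle.kink a) D E) :
      ReidemeisterMove D E
  | two {D E : LinkDiagram} (a : Bool) (h : LocalMove Tangle.arcs (Tangle.pushed a) D E) :
      ReidemeisterMove D E
  | three {D E : LinkDiagram} (a : Bool)
      (h : LocalMove (Tangle.overBelow a) (Tangle.overAbove a) D E) : ReidemeisterMove D E

/-- The diagrams present isotopic (unoriented) links. -/
def Isotopic : LinkDiagram → LinkDiagram → Prop := Relation.EqvGen ReidemeisterMove

/-- A 3-move: two parallel strands are twisted around each other by three half twists. -/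
def ThreeMove (D E : LinkDiagram) : Prop :=
  ∃ a : Bool, LocalMove Tangle.arcs (Tangle.threeTwists a) D E

/-- Related by isotopies and a finite sequence of 3-moves and their inverses. -/
def ThreeEquivalent : LinkDiagram → LinkDiagram → Prop :=
  Relation.EqvGen fun D E => ReidemeisterMove D E ∨ ThreeMove D E

/-- Not isotopic to the mirror image (whatever the orientations). -/
def IsChiral (K : LinkDiagram) : Prop := ¬ Isotopic K K.mirror

end LinkDiagram

/-!
The proof evaluates the Kauffman bracket at a primitive 24-th root of unity `A`, with `B = A⁻¹`;
the loop value `δ = -A² - B²` then satisfies `δ² = 3`.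

*3-moves.* A half twist of two strands is `A + B e`, where `e` is the other smoothing and `e² = δ
e`. In the third power the coefficient of `e` vanishes exactly because `A ^ 12 = -1`, so that a
3-move multiplies the bracket by `A ^ 3` or `B ^ 3` (`bracket_threeTwists`). The first
Reidemeister move multiplies it by `-A ^ 3` or `-B ^ 3`, the others preserve it. All these rules
come from one gluing formula: the states of a small tangle contribute to the bracket of a larger
diagram only through their arcs and their number of closed loops (`card_loops_glue`,
`bracket_glue_eq_mul`); for the tangles in question these data are found by evaluation. Hence if
`K` is 3-equivalent to the unlink of `2 * m` components, its bracket is `A ^ (3 * j) * 3 ^ m`,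
with an exponent `j` that is the same for all primitive 24-th roots of unity `A`
(`bracketAssociated_of_threeEquivalent`).

*Mirror images.* The bracket normalized by the writhe is the Jones polynomial, an invariant of
oriented links (`jonesLE_of_isotopic`), and for a knot it does not depend on the orientation. At
`A` its value for `K` is `A ^ (3 * k) * 3 ^ m` for some `k`, and its value for the mirror image is
the value for `K` at `B`. If `K` is isotopic to its mirror image, it follows that `A ^ (6 * k) =
1`, so `4 ∣ k` and the value is `3 ^ m` or `-3 ^ m`, with the same sign at `A` and at `A ^ 7`.

*Contradiction.* For a knot, however, the normalized bracket lies in `A² ℤ[A⁴, A⁻⁴]`, so it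
changes its sign when `A` is replaced by `A ^ 7 = A ^ 6 * A` (`IsOrientation.jones_fourth_root`).
This is a statement about the parity of the number of loops of a state. Changing a smoothing
changes the number of loops by an odd number, since a product of two involutions is multiplied by a
transposition on one half of the darts; that half is given by a colouring of the darts that is
alternating at every crossing, which exists because the diagram is planar
(`IsPlanar.exists_alternating`). The same argument with an orientation of the knot in place of the
colouring relates the smoothing that respects the orientation to the single component of the knot.

All of this works over any field of characteristic different from 2 and 3 with a primitive 24-th
root of unity, such as the field with 73 elements.
-/

/-! ### Resolutions of the crossings, and their loops -/

namespace Dart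

variable {X P Y Q : Type} {k : ℕ}

/-- Join the four darts at each crossing `x` in pairs, as prescribed by the involution `ρ x`, and
the two darts at each marked point.  This covers the two smoothings of a crossing as well as the
passage straight through it. -/
def reconnect (ρ : X → Fin 4 → Fin 4) : Dart X P k → Dart X P k
  | cross x c => cross x (ρ x c)
  | mark p b => mark p (!b)
  | tip i => tip i

/-- The smoothing of the crossings in the Kauffman state `s`.  At a crossing in the state `true` it
joins the darts `0, 1` and `2, 3`, which is the smoothing of weight `A`; in the state `false`
it joins the darts `0, 3` and `1, 2`. -/
def smoothing (s : X → Bool) (x : X) (c : Fin 4) : Fin 4 := (if s x then 1 else 3) - c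

theorem straight_eq_reconnect :
    (straight : Dart X P k → Dart X P k) = reconnect fun _ c => c + 2 := by
  funext d; cases d <;> rfl

theorem smoothing_elim (s : X → Bool) (t : Y → Bool) :
    smoothing (Sum.elim s t) = Sum.elim (smoothing s) (smoothing t) := by
  funext x; cases x <;> rfl

end Dart

namespace Tangle

variable {k : ℕ}

/-- The curves that remain when the crossings are reconnected by `ρ`. -/
abbrev Loops (T : Tangle k) (ρ : T.X → Fin 4 → Fin 4) : Type :=
  Quot fun d e : T.D => e = reconnect ρ d ∨ e = T.edge d

/-- `key` selects one dart on each curve of the tangle `T` reconnected by `ρ`, and it selects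
an end on each curve that is not closed. -/
structure Resolves (T : Tangle k) (ρ : T.X → Fin 4 → Fin 4) (key : T.D → T.D) : Prop where
  key_reconnect : ∀ d, key (reconnect ρ d) = key d
  key_edge : ∀ d, key (T.edge d) = key d
  mk_key : ∀ d, (Quot.mk _ (key d) : T.Loops ρ) = Quot.mk _ d

/-- The closed curves of a reconnected tangle, through the selected darts. -/
abbrev Closed (T : Tangle k) (key : T.D → T.D) : Type :=
  {d : T.D // key d = d ∧ ∀ i, d ≠ tip i}

/-- The curves of the tangle `S` reconnected by `ρ`, after its `i`-th end has been joined to its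
`r i`-th end outside of the disc, where the ends are numbered clockwise. -/
abbrev Closure (S : Tangle k) (ρ : S.X → Fin 4 → Fin 4) (r : Fin k → Fin k) : Type :=
  Quot fun d e : S.D => e = reconnect ρ d ∨ e = S.edge d ∨
    ∃ i : Fin k, d = tip i.rev ∧ e = tip (r i).rev

/-- A function on darts that is constant along the curves takes the same value on darts of the
same curve. -/
theorem Loops.eq_of_mk_eq {T : Tangle k} {ρ : T.X → Fin 4 → Fin 4} {α : Type*} (f : T.D → α)
    (hr : ∀ d, f (reconnect ρ d) = f d) (he : ∀ d, f (T.edge d) = f d) {d e : T.D}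
    (h : (Quot.mk _ d : T.Loops ρ) = Quot.mk _ e) : f d = f e := by
  refine congrArg (Quot.lift f ?_) h
  rintro a b (rfl | rfl)
  · exact (hr a).symm
  · exact (he a).symm

open Classical in
/-- The loops in the union of two tangles are those of the first one, closed up by the arcs of
the second one, and the closed loops in the second one. -/
theorem card_loops_glue (S T : Tangle k) (ρ : S.X → Fin 4 → Fin 4) (τ : T.X → Fin 4 → Fin 4)
    {key : T.D → T.D} (hk : T.Resolves τ key) (r : Fin k → Fin k)
    (hr : ∀ i, key (tip i) = tip (r i)) :
    Nat.card ((S.glue T).Loops (Sum.elim ρ τ)) =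
      Nat.card (S.Closure ρ r) + Nat.card (T.Closed key) := by
  have key_key : ∀ d, key (key d) = key d := fun d =>
    Loops.eq_of_mk_eq key hk.key_reconnect hk.key_edge (hk.mk_key d)
  let m : S.D → S.Closure ρ r := Quot.mk _
  have m_rec : ∀ d, m (reconnect ρ d) = m d := fun d => by
    symm; exact (Quot.sound (Or.inl rfl))
  have m_edge : ∀ d, m (S.edge d) = m d := fun d => by
    symm; exact (Quot.sound (Or.inr (Or.inl rfl)))
  have m_tip : ∀ i : Fin k, m (tip i.rev) = m (tip (r i).rev) := fun i =>
    Quot.sound (Or.inr (Or.inr ⟨i, rfl, rfl⟩))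
  let g : Dart (S.X ⊕ T.X) ((S.P ⊕ T.P) ⊕ Fin k) 0 → (S.glue T).Loops (Sum.elim ρ τ) := Quot.mk _
  have g_rec : ∀ d, g (reconnect (Sum.elim ρ τ) d) = g d := fun d => by
    symm; exact (Quot.sound (Or.inl rfl))
  have g_edge : ∀ d, g (glueEdge S T d) = g d := fun d => by
    symm; exact (Quot.sound (Or.inr rfl))
  -- the curve of a dart on the right: either it reaches an end, or it is closed
  let ψ : T.D → S.Closure ρ r ⊕ T.Closed key := fun d =>
    if h : ∃ i, key d = tip i then Sum.inl (m (tip h.choose.rev))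
    else Sum.inr ⟨key d, key_key d, fun i hi => h ⟨i, hi⟩⟩
  have ψ_congr : ∀ d e, key d = key e → ψ d = ψ e := by
    intro d e h
    simp only [ψ, h]
  have ψ_tip : ∀ d i, key d = tip i → ψ d = Sum.inl (m (tip i.rev)) := by
    intro d i h
    have h' : ∃ i, key d = tip i := ⟨i, h⟩
    have : h'.choose = i := (Dart.tip.inj (h.symm.trans h'.choose_spec)).symm
    simp only [ψ, dif_pos h', this]
  have ψ_closed : ∀ d : T.Closed key, ψ d = Sum.inr d := by
    intro d
    have h' : ¬ ∃ i, key d.1 = tip i := by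
      rintro ⟨i, hi⟩
      exact d.2.2 i (d.2.1 ▸ hi)
    simp only [ψ, dif_neg h']
    congr 1
    exact Subtype.ext d.2.1
  let φ : Dart (S.X ⊕ T.X) ((S.P ⊕ T.P) ⊕ Fin k) 0 → S.Closure ρ r ⊕ T.Closed key
    | cross (Sum.inl x) s => Sum.inl (m (cross x s))
    | cross (Sum.inr y) s => ψ (cross y s)
    | mark (Sum.inl (Sum.inl p)) b => Sum.inl (m (mark p b))
    | mark (Sum.inl (Sum.inr q)) b => ψ (mark q b)
    | mark (Sum.inr i) false => Sum.inl (m (tip i))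
    | mark (Sum.inr i) true => ψ (tip i.rev)
  have φl : ∀ d : S.D, φ (inLeft d) = Sum.inl (m d) := by
    rintro (_ | _ | _) <;> rfl
  have φr : ∀ d : T.D, φ (inRight d) = ψ d := by
    rintro (_ | _ | i)
    · rfl
    · rfl
    · change ψ (tip i.rev.rev) = _
      rw [Fin.rev_rev]
  have φtip : ∀ i, φ (mark (Sum.inr i) false) = φ (mark (Sum.inr i) true) := by
    intro i
    change Sum.inl (m (tip i)) = ψ (tip i.rev)
    rw [ψ_tip _ _ (hr i.rev), ← m_tip, Fin.rev_rev]
  have φrec : ∀ d, φ (reconnect (Sum.elim ρ τ) d) = φ d := by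
    rintro (⟨x | y, s⟩ | ⟨(p | q) | i, b⟩ | i)
    · exact congrArg Sum.inl (m_rec (cross x s))
    · exact ψ_congr _ _ (hk.key_reconnect (cross y s))
    · exact congrArg Sum.inl (m_rec (mark p b))
    · exact ψ_congr _ _ (hk.key_reconnect (mark q b))
    · cases b
      · exact (φtip i).symm
      · exact φtip i
    · exact i.elim0
  have φedge : ∀ d, φ (glueEdge S T d) = φ d := by
    intro d
    rcases glue_cases S T d with ⟨e, rfl⟩ | ⟨e, rfl⟩
    · rw [glueEdge_inLeft, φl, φl, m_edge]
    · rw [glueEdge_inRight, φr, φr]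
      exact ψ_congr _ _ (hk.key_edge e)
  have g_right : ∀ d e : T.D, (Quot.mk _ d : T.Loops τ) = Quot.mk _ e →
      g (inRight d) = g (inRight e) := by
    refine fun d e => Loops.eq_of_mk_eq (fun d => g (inRight d)) ?_ ?_
    · rintro (⟨y, s⟩ | ⟨q, b⟩ | i)
      · exact g_rec (cross (Sum.inr y) s)
      · exact g_rec (mark (Sum.inl (Sum.inr q)) b)
      · rfl
    · intro d
      rw [← glueEdge_inRight, g_edge]
  have g_tip : ∀ i : Fin k, g (inLeft (tip i.rev)) = g (inRight (tip i)) := fun i =>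
    (g_rec (mark (Sum.inr i.rev) false)).symm
  let χ : S.Closure ρ r ⊕ T.Closed key → (S.glue T).Loops (Sum.elim ρ τ) := Sum.elim
    (Quot.lift (fun d => g (inLeft d)) (by
      rintro a b (rfl | rfl | ⟨i, rfl, rfl⟩)
      · rcases a with ⟨y, s⟩ | ⟨q, b⟩ | i
        · exact (g_rec (cross (Sum.inl y) s)).symm
        · exact (g_rec (mark (Sum.inl (Sum.inl q)) b)).symm
        · rfl
      · rw [← glueEdge_inLeft, g_edge]
      · rw [g_tip, g_tip]
        exact g_right _ _ (by rw [← hk.mk_key, hr])))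
    fun d => g (inRight d.1)
  have χψ : ∀ d, χ (ψ d) = g (inRight d) := by
    intro d
    by_cases h : ∃ i, key d = tip i
    · obtain ⟨i, hi⟩ := h
      rw [ψ_tip d i hi]
      exact (g_tip i).trans (g_right _ _ (by rw [← hi, hk.mk_key]))
    · simp only [ψ, dif_neg h]
      exact g_right _ _ (hk.mk_key d)
  rw [← Nat.card_sum]
  refine Nat.card_congr
    { toFun := Quot.lift φ ?_, invFun := χ, left_inv := ?_, right_inv := ?_ }
  · rintro a b (rfl | rfl)
    · exact (φrec a).symm
    · exact (φedge a).symm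
  · rintro ⟨d⟩
    change χ (φ d) = g d
    rcases glue_cases S T d with ⟨e, rfl⟩ | ⟨e, rfl⟩
    · rw [φl]; rfl
    · rw [φr, χψ]
  · rintro (q | d)
    · obtain ⟨d, rfl⟩ := Quot.exists_rep q
      exact φl d
    · exact (φr d.1).trans (ψ_closed d)

/-! ### The Kauffman bracket -/

variable {R : Type*} [CommRing R]

/-- The monomial in `A` and `B` of a Kauffman state. -/
def stateWeight {X : Type} [Fintype X] (A B : R) (s : X → Bool) : R :=
  ∏ x, if s x then A else B

/-- The Kauffman bracket, normalized to `1` on the empty diagram, with `B` in the role of `A⁻¹`. -/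
noncomputable def bracket (T : Tangle 0) (A B : R) : R :=
  letI := Fintype.ofFinite T.X
  letI := Classical.decEq T.X
  ∑ s : T.X → Bool, stateWeight A B s * (-A ^ 2 - B ^ 2) ^ Nat.card (T.Loops (smoothing s))

theorem bracket_eq_sum (T : Tangle 0) [i : Fintype T.X] [j : DecidableEq T.X] (A B : R) :
    T.bracket A B =
      ∑ s : T.X → Bool, stateWeight A B s *
        (-A ^ 2 - B ^ 2) ^ Nat.card (T.Loops (smoothing s)) := by
  have hi : Fintype.ofFinite T.X = i := Subsingleton.elim _ _
  have hj : Classical.decEq T.X = j := Subsingleton.elim _ _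
  subst hi hj
  rfl

/-- The contribution of a tangle `T` to the bracket of `S.glue T`, where `F r` stands for the
contribution of `S` when the arcs of `T` join the `i`-th end to the `r i`-th end. -/
noncomputable def localBracket (T : Tangle k) [Fintype T.X] [DecidableEq T.X]
    (key : (T.X → Bool) → T.D → T.D) (r : (T.X → Bool) → Fin k → Fin k) (A B : R)
    (F : (Fin k → Fin k) → R) : R :=
  ∑ t : T.X → Bool, stateWeight A B t * (-A ^ 2 - B ^ 2) ^ Nat.card (T.Closed (key t)) * F (r t)

theorem bracket_glue (S T : Tangle k) [Fintype S.X] [DecidableEq S.X]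
    [Fintype T.X] [DecidableEq T.X] {key : (T.X → Bool) → T.D → T.D}
    (hk : ∀ t, T.Resolves (smoothing t) (key t)) {r : (T.X → Bool) → Fin k → Fin k}
    (hr : ∀ t i, key t (tip i) = tip (r t i)) (A B : R) :
    (S.glue T).bracket A B = ∑ s : S.X → Bool, stateWeight A B s *
      T.localBracket key r A B
        fun r => (-A ^ 2 - B ^ 2) ^ Nat.card (S.Closure (smoothing s) r) := by
  have e1 := (S.glue T).bracket_eq_sum (i := inferInstanceAs (Fintype (S.X ⊕ T.X)))
    (j := inferInstanceAs (DecidableEq (S.X ⊕ T.X))) A B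
  rw [e1]
  refine ((Equiv.sumArrowEquivProdArrow S.X T.X Bool).symm.sum_comp _).symm.trans ?_
  rw [Fintype.sum_prod_type]
  refine Finset.sum_congr rfl fun s _ => ?_
  rw [localBracket, Finset.mul_sum]
  refine Finset.sum_congr rfl fun t _ => ?_
  have h1 : Nat.card ((S.glue T).Loops (smoothing (Sum.elim s t : S.X ⊕ T.X → Bool))) =
      Nat.card (S.Closure (smoothing s) (r t)) + Nat.card (T.Closed (key t)) := by
    rw [← card_loops_glue S T (smoothing s) _ (hk t) (r t) (hr t), ← smoothing_elim]
    rfl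
  have h2 : stateWeight A B (Sum.elim s t) = stateWeight A B s * stateWeight A B t :=
    Fintype.prod_sum_type _
  refine (congrArg₂ (· * ·) h2 (congrArg ((-A ^ 2 - B ^ 2) ^ ·) h1)).trans ?_
  simp only [pow_add]
  ring

end Tangle

/-! ### Tracing the arcs of small tangles -/

namespace Tangle

variable {n k : ℕ}

/-- A numbering of the darts of a small tangle in which the ends come first. -/
def rank : Dart (Fin n) Empty k → ℕ
  | tip i => i
  | cross x c => k + (4 * x + c)

/-- The dart of smaller rank. -/
def lower (d e : Dart (Fin n) Empty k) : Dart (Fin n) Empty k :=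
  match Nat.blt (rank d) (rank e) with
  | true => d
  | false => e

/-- `f d`, where `d` is brought into constructor form first; without this, the evaluation of
`walk` by the kernel duplicates unevaluated darts. -/
def force {α : Type*} (d : Dart (Fin n) Empty k) (f : Dart (Fin n) Empty k → α) : α :=
  match d with
  | tip i => f (tip i)
  | cross x c => f (cross x c)
  | mark p b => f (mark p b)

theorem force_eq {α : Type*} (d : Dart (Fin n) Empty k) (f : Dart (Fin n) Empty k → α) :
    force d f = f d := by
  cases d <;> rfl

/-- Follow the curve of `e` in the state `t` for `2 * l` darts and return the dart of least rank
among these and `m`. -/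
def walk (edge : Dart (Fin n) Empty k → Dart (Fin n) Empty k) (t : Fin n → Bool) :
    ℕ → Dart (Fin n) Empty k → Dart (Fin n) Empty k → Dart (Fin n) Empty k
  | 0, _, m => m
  | l + 1, e, m => force (edge e) fun e => force (lower e m) fun m =>
      force (reconnect (smoothing t) e) fun e => force (lower e m) fun m => walk edge t l e m

/-- The dart of least rank on the curve of `d` in the state `t`. -/
def leastDart (edge : Dart (Fin n) Empty k → Dart (Fin n) Empty k) (t : Fin n → Bool)
    (d : Dart (Fin n) Empty k) : Dart (Fin n) Empty k := walk edge t (4 * n + k) d d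

/-- In the state `t`, the tangle has `c` closed loops, and each end `i` is joined to `r i` by an
arc or equal to `r i`.  This is in a form that can be checked by evaluation. -/
def HasArcs (edge : Dart (Fin n) Empty k → Dart (Fin n) Empty k) (t : Fin n → Bool)
    (r : Fin k → Fin k) (c : ℕ) : Prop :=
  (∀ d, leastDart edge t (reconnect (smoothing t) d) = leastDart edge t d) ∧
  (∀ d, leastDart edge t (edge d) = leastDart edge t d) ∧
  (∀ i, leastDart edge t (tip i) = tip (r i)) ∧
  Fintype.card {d : Dart (Fin n) Empty k // leastDart edge t d = d ∧ ∀ i, d ≠ tip i} = c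

instance (edge : Dart (Fin n) Empty k → Dart (Fin n) Empty k) (t : Fin n → Bool)
    (r : Fin k → Fin k) (c : ℕ) : Decidable (HasArcs edge t r c) :=
  inferInstanceAs (Decidable (_ ∧ _ ∧ _ ∧ _))

theorem mk_walk {l : List (Dart (Fin n) Empty k × Dart (Fin n) Empty k)}
    {h : ∀ d, partner l (partner l d) = d ∧ partner l d ≠ d} (t : Fin n → Bool)
    (d : Dart (Fin n) Empty k) (j : ℕ) :
    (Quot.mk _ (walk (partner l) t j d d) : (ofPairs n k l h).Loops (smoothing t)) =
      Quot.mk _ d := by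
  let g : Dart (Fin n) Empty k → (ofPairs n k l h).Loops (smoothing t) := Quot.mk _
  have g_edge : ∀ d, g (partner l d) = g d := fun d => by symm; exact Quot.sound (Or.inr rfl)
  have g_rec : ∀ d, g (reconnect (smoothing t) d) = g d := fun d => by
    symm; exact Quot.sound (Or.inl rfl)
  have hlow : ∀ d e q, g d = q → g e = q → g (lower d e) = q := by
    intro d e q hd he
    unfold lower
    split
    · exact hd
    · exact he
  have key : ∀ j e m, g m = g e → g (walk (partner l) t j e m) = g e := by
    intro j
    induction j with
    | zero => exact fun e m hm => hm
    | succ j ih =>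
      intro e m hm
      simp only [walk, force_eq]
      have h2 : g (reconnect (smoothing t) (partner l e)) = g e := (g_rec _).trans (g_edge e)
      rw [← h2]
      exact ih _ _ (hlow _ _ _ rfl (hlow _ _ _ (g_rec _).symm (hm.trans h2.symm)))
  exact key j d d rfl

variable {R : Type*} [CommRing R]

/-- The bracket of a closed diagram through the states of a small tangle `T` in it. -/
theorem bracket_glue_ofPairs (S : Tangle k)
    (l : List (Dart (Fin n) Empty k × Dart (Fin n) Empty k))
    (h : ∀ d, partner l (partner l d) = d ∧ partner l d ≠ d)
    {r : (Fin n → Bool) → Fin k → Fin k} {c : (Fin n → Bool) → ℕ}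
    (hr : ∀ t, HasArcs (partner l) t (r t) (c t)) (A B : R) :
    letI := Fintype.ofFinite S.X
    letI := Classical.decEq S.X
    (S.glue (ofPairs n k l h)).bracket A B = ∑ s : S.X → Bool, stateWeight A B s *
      ∑ t : Fin n → Bool, stateWeight A B t * (-A ^ 2 - B ^ 2) ^ c t *
        (-A ^ 2 - B ^ 2) ^ Nat.card (S.Closure (smoothing s) (r t)) := by
  let := Fintype.ofFinite S.X
  let := Classical.decEq S.X
  let : Fintype (ofPairs n k l h).X := inferInstanceAs (Fintype (Fin n))
  let : DecidableEq (ofPairs n k l h).X := inferInstanceAs (DecidableEq (Fin n))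
  have := bracket_glue S (ofPairs n k l h) (key := fun t => leastDart (partner l) t)
    (fun t => ⟨(hr t).1, (hr t).2.1, fun d => mk_walk t d _⟩) (r := r)
    (fun t => (hr t).2.2.1) A B
  refine this.trans (Finset.sum_congr rfl fun s _ => congrArg _
    (Finset.sum_congr rfl fun t _ => ?_))
  have hc : Nat.card ((ofPairs n k l h).Closed (leastDart (partner l) t)) = c t :=
    (Nat.card_eq_fintype_card (α := {d : Dart (Fin n) Empty k //
      leastDart (partner l) t d = d ∧ ∀ i, d ≠ tip i})).trans (hr t).2.2.2
  rw [hc]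
  rfl

/-- A multiplicative relation between the local contributions of two small tangles gives the same
relation between the brackets of all diagrams that differ by these tangles. -/
theorem bracket_glue_eq_mul (S : Tangle k) {n' : ℕ}
    (l : List (Dart (Fin n) Empty k × Dart (Fin n) Empty k))
    (h : ∀ d, partner l (partner l d) = d ∧ partner l d ≠ d)
    (l' : List (Dart (Fin n') Empty k × Dart (Fin n') Empty k))
    (h' : ∀ d, partner l' (partner l' d) = d ∧ partner l' d ≠ d)
    {r : (Fin n → Bool) → Fin k → Fin k} {c : (Fin n → Bool) → ℕ}
    {r' : (Fin n' → Bool) → Fin k → Fin k} {c' : (Fin n' → Bool) → ℕ}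
    (hr : ∀ t, HasArcs (partner l) t (r t) (c t)) (hr' : ∀ t, HasArcs (partner l') t (r' t) (c' t))
    {A B u : R}
    (hu : ∀ F : (Fin k → Fin k) → R,
      ∑ t : Fin n → Bool, stateWeight A B t * (-A ^ 2 - B ^ 2) ^ c t * F (r t) =
      u * ∑ t : Fin n' → Bool, stateWeight A B t * (-A ^ 2 - B ^ 2) ^ c' t * F (r' t)) :
    (S.glue (ofPairs n k l h)).bracket A B = u * (S.glue (ofPairs n' k l' h')).bracket A B := by
  rw [bracket_glue_ofPairs S l h hr, bracket_glue_ofPairs S l' h' hr', Finset.mul_sum]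
  refine Finset.sum_congr rfl fun s _ => ?_
  rw [hu fun r => (-A ^ 2 - B ^ 2) ^ Nat.card (S.Closure (smoothing s) r)]
  ring

theorem sum_states_succ (f : (Fin (n + 1) → Bool) → R) :
    ∑ t, f t = ∑ t : Fin n → Bool, (f (Matrix.vecCons true t) + f (Matrix.vecCons false t)) := by
  rw [← (Fin.consEquiv fun _ => Bool).sum_comp, Fintype.sum_prod_type, Fintype.sum_bool,
    ← Finset.sum_add_distrib]
  rfl

theorem stateWeight_cons_true (A B : R) (t : Fin n → Bool) :
    stateWeight A B (Matrix.vecCons true t) = A * stateWeight A B t := by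
  simp [stateWeight, Fin.prod_univ_succ]

theorem stateWeight_cons_false (A B : R) (t : Fin n → Bool) :
    stateWeight A B (Matrix.vecCons false t) = B * stateWeight A B t := by
  simp [stateWeight, Fin.prod_univ_succ]

theorem forall_states_succ {p : (Fin (n + 1) → Bool) → Prop}
    (h : ∀ b t, p (Matrix.vecCons b t)) (t : Fin (n + 1) → Bool) : p t := by
  have := h (t 0) (Fin.tail t)
  rwa [show Matrix.vecCons (t 0) (Fin.tail t) = t from Fin.cons_self_tail t] at this

theorem forall_states_zero {p : (Fin 0 → Bool) → Prop}
    (h : p ![]) (t : Fin 0 → Bool) : p t := by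
  rwa [Subsingleton.elim t ![]]

end Tangle

/-! ### The bracket under the local moves -/

namespace Tangle

variable {R : Type*} [CommRing R] {A B : R}

/-- The involution `arc.edge`, on an explicit type of darts; likewise for the definitions below. -/
def arcEdge : Dart (Fin 0) Empty 2 → Dart (Fin 0) Empty 2 := arc.edge

def kinkEdge (a : Bool) : Dart (Fin 1) Empty 2 → Dart (Fin 1) Empty 2 := (kink a).edge

def arcsEdge : Dart (Fin 0) Empty 4 → Dart (Fin 0) Empty 4 := arcs.edge

def pushedEdge (a : Bool) : Dart (Fin 2) Empty 4 → Dart (Fin 2) Empty 4 := (pushed a).edge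

def threeTwistsEdge (a : Bool) : Dart (Fin 3) Empty 4 → Dart (Fin 3) Empty 4 :=
  (threeTwists a).edge

def overBelowEdge (a : Bool) : Dart (Fin 3) Empty 6 → Dart (Fin 3) Empty 6 := (overBelow a).edge

def overAboveEdge (a : Bool) : Dart (Fin 3) Empty 6 → Dart (Fin 3) Empty 6 := (overAbove a).edge

theorem hasArcs_arc (t : Fin 0 → Bool) : HasArcs arcEdge t ![0, 0] 0 :=
  forall_states_zero (p := fun t => HasArcs arcEdge t ![0, 0] 0) (by decide +kernel) t

theorem hasArcs_arcs (t : Fin 0 → Bool) : HasArcs arcsEdge t ![0, 0, 2, 2] 0 :=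
  forall_states_zero (p := fun t => HasArcs arcsEdge t ![0, 0, 2, 2] 0) (by decide +kernel) t

theorem hasArcs_kink (a : Bool) (t : Fin 1 → Bool) :
    HasArcs (kinkEdge a) t ![0, 0] (if t 0 = a then 0 else 1) := by
  revert a t
  refine fun a => forall_states_succ fun b0 => forall_states_zero ?_
  revert a b0
  decide +kernel

theorem hasArcs_pushed (a : Bool) (t : Fin 2 → Bool) : HasArcs (pushedEdge a) t
    (if t 0 = !a ∧ t 1 = a then ![0, 0, 2, 2] else ![0, 1, 1, 0])
    (if t 0 = a ∧ t 1 = !a then 1 else 0) := by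
  revert a t
  refine fun a => forall_states_succ fun b0 => forall_states_succ fun b1 => forall_states_zero ?_
  revert a b0 b1
  decide +kernel

theorem hasArcs_threeTwists (a : Bool) (t : Fin 3 → Bool) : HasArcs (threeTwistsEdge a) t
    (if t 0 = !a ∧ t 1 = !a ∧ t 2 = !a then ![0, 0, 2, 2] else ![0, 1, 1, 0])
    ((if t 0 = a then 1 else 0) + (if t 1 = a then 1 else 0) + (if t 2 = a then 1 else 0) - 1) := by
  revert a t
  refine fun a => forall_states_succ fun b0 => forall_states_succ fun b1 =>
    forall_states_succ fun b2 => forall_states_zero ?_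
  revert a b0 b1 b2
  decide +kernel

/-- The arcs of `overBelow a` in the state in which the two crossings on the horizontal strand have
the states `b₀` and `b₁`, and the third one has the state `a` if and only if the last argument
is true. -/
def overBelowArcs : Bool → Bool → Bool → Fin 6 → Fin 6
  | false, false, true => ![0, 0, 2, 3, 3, 2]
  | true, false, true => ![0, 1, 1, 3, 3, 0]
  | true, false, false => ![0, 1, 1, 0, 4, 4]
  | true, true, true => ![0, 1, 2, 2, 1, 0]
  | _, _, _ => ![0, 0, 2, 2, 4, 4]

/-- The arcs of `overAbove a`, with the same conventions as for `overBelowArcs`. -/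
def overAboveArcs : Bool → Bool → Bool → Fin 6 → Fin 6
  | false, false, true => ![0, 0, 2, 3, 3, 2]
  | true, false, true => ![0, 0, 2, 2, 4, 4]
  | true, false, false => ![0, 1, 1, 0, 4, 4]
  | true, true, true => ![0, 1, 2, 2, 1, 0]
  | _, _, _ => ![0, 1, 1, 3, 3, 0]

theorem hasArcs_overBelow (a : Bool) (t : Fin 3 → Bool) : HasArcs (overBelowEdge a) t
    (overBelowArcs (t 0) (t 1) (t 2 == a))
    (if t 0 = false ∧ t 1 = true ∧ t 2 = !a then 1 else 0) := by
  revert a t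
  refine fun a => forall_states_succ fun b0 => forall_states_succ fun b1 =>
    forall_states_succ fun b2 => forall_states_zero ?_
  revert a b0 b1 b2
  decide +kernel

theorem hasArcs_overAbove (a : Bool) (t : Fin 3 → Bool) : HasArcs (overAboveEdge a) t
    (overAboveArcs (t 0) (t 1) (t 2 == a))
    (if t 0 = false ∧ t 1 = true ∧ t 2 = !a then 1 else 0) := by
  revert a t
  refine fun a => forall_states_succ fun b0 => forall_states_succ fun b1 =>
    forall_states_succ fun b2 => forall_states_zero ?_
  revert a b0 b1 b2
  decide +kernel

theorem bracket_kink (S : Tangle 2) (a : Bool) (h : A * B = 1) :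
    (S.glue (kink a)).bracket A B =
      (if a then -B ^ 3 else -A ^ 3) * (S.glue arc).bracket A B := by
  refine bracket_glue_eq_mul S _ _ _ _ (hasArcs_kink a) hasArcs_arc fun F => ?_
  cases a <;> simp [sum_states_succ, stateWeight_cons_true, stateWeight_cons_false] <;> grind

theorem bracket_pushed (S : Tangle 4) (a : Bool) (h : A * B = 1) :
    (S.glue (pushed a)).bracket A B = (S.glue arcs).bracket A B := by
  refine (bracket_glue_eq_mul (u := 1) S _ _ _ _ (hasArcs_pushed a) hasArcs_arcs
    fun F => ?_).trans (one_mul _)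
  cases a <;> simp [sum_states_succ, stateWeight_cons_true, stateWeight_cons_false] <;> grind

/-- If `A ^ 12 = -1`, the three half twists act on the two strands by a scalar: the coefficient of
the other smoothing vanishes. -/
theorem bracket_threeTwists (S : Tangle 4) (a : Bool) (h : A * B = 1)
    (hA : A ^ 8 - A ^ 4 + 1 = 0) :
    (S.glue (threeTwists a)).bracket A B =
      (if a then B ^ 3 else A ^ 3) * (S.glue arcs).bracket A B := by
  refine bracket_glue_eq_mul S _ _ _ _ (hasArcs_threeTwists a) hasArcs_arcs fun F => ?_
  cases a <;> simp [sum_states_succ, stateWeight_cons_true, stateWeight_cons_false] <;> grind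

theorem bracket_overBelow (S : Tangle 6) (a : Bool) (h : A * B = 1) :
    (S.glue (overBelow a)).bracket A B = (S.glue (overAbove a)).bracket A B := by
  refine (bracket_glue_eq_mul (u := 1) S _ _ _ _ (hasArcs_overBelow a) (hasArcs_overAbove a)
    fun F => ?_).trans (one_mul _)
  cases a <;> simp [overBelowArcs, overAboveArcs, sum_states_succ, stateWeight_cons_true,
    stateWeight_cons_false] <;> grind

end Tangle

/-! ### Orientations and the writhe -/

namespace Tangle

variable {k : ℕ} {R : Type*} [CommRing R] {A B : R}

/-- An orientation of the strands, where `o d` says that the dart `d` points away from its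
vertex. -/
structure IsOrientation (T : Tangle k) (o : T.D → Bool) : Prop where
  cross : ∀ x c, o (cross x (c + 2)) = !o (cross x c)
  mark : ∀ p b, o (mark p (!b)) = !o (mark p b)
  edge : ∀ d, o (T.edge d) = !o d

/-- The product of `-B ^ 3` over the positive crossings and `-A ^ 3` over the negative crossings;
for `B = A⁻¹` this is `(-A ^ 3) ^ (-w)`, where `w` is the writhe. -/
noncomputable def writheFactor (T : Tangle k) (o : T.D → Bool) (A B : R) : R :=
  letI := Fintype.ofFinite T.X
  ∏ x : T.X, if o (cross x 1) = o (cross x 2) then -B ^ 3 else -A ^ 3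

theorem writheFactor_eq_prod (T : Tangle k) [i : Fintype T.X] (o : T.D → Bool) (A B : R) :
    T.writheFactor o A B = ∏ x : T.X, if o (cross x 1) = o (cross x 2) then -B ^ 3 else -A ^ 3 := by
  have hi : Fintype.ofFinite T.X = i := Subsingleton.elim _ _
  subst hi
  rfl

/-- The bracket normalized by the writhe: the Jones polynomial of the oriented link, up to a
change of variables. -/
noncomputable def jones (T : Tangle 0) (o : T.D → Bool) (A B : R) : R :=
  T.writheFactor o A B * T.bracket A B

/-! ### Isomorphisms of diagrams -/

theorem Iso.symm {S T : Tangle k} (h : S.Iso T) : T.Iso S := by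
  obtain ⟨f, hr, he, ho, ht⟩ := h
  refine ⟨f.symm, fun d => ?_, fun d => ?_, fun d => ?_, fun i => ?_⟩
  · rw [Equiv.symm_apply_eq, hr, Equiv.apply_symm_apply]
  · rw [Equiv.symm_apply_eq, he, Equiv.apply_symm_apply]
  · rw [← ho, Equiv.apply_symm_apply]
  · rw [Equiv.symm_apply_eq, ht]

/-- An isomorphism maps crossings to crossings, up to a rotation by a half turn. -/
theorem Iso.exists_equiv {S T : Tangle 0} {f : S.D ≃ T.D} (hr : ∀ d, f (rot d) = rot (f d))
    (ho : ∀ d, (f d).IsOver ↔ d.IsOver) :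
    ∃ g : S.X ≃ T.X, ∀ x, (∀ c, f (cross x c) = cross (g x) c) ∨
      ∀ c, f (cross x c) = cross (g x) (c + 2) := by
  have h : ∀ x, ∃ y, (∀ c, f (cross x c) = cross y c) ∨ ∀ c, f (cross x c) = cross y (c + 2) := by
    intro x
    have h1 : (f (cross x 1)).IsOver := (ho _).2 (Or.inl rfl)
    have h2 := hr (cross x 1)
    have h3 := hr (rot (cross x 1))
    have h4 := hr (rot (rot (cross x 1)))
    rw [h2] at h3
    rw [h3] at h4
    rcases hf : f (cross x 1) with ⟨y, s⟩ | ⟨q, b⟩ | i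
    · rw [hf] at h1 h2 h3 h4
      refine ⟨y, ?_⟩
      rcases h1 with rfl | rfl
      · left
        intro c
        fin_cases c
        · exact h4
        · exact hf
        · exact h2
        · exact h3
      · right
        intro c
        fin_cases c
        · exact h4
        · exact hf
        · exact h2
        · exact h3
    · rw [hf] at h1; exact h1.elim
    · exact i.elim0
  choose g hg using h
  have hinj : Function.Injective g := by
    intro x x' hx
    have key : ∀ x, ∃ c, f (cross x c) = cross (g x) 0 := by
      intro x
      rcases hg x with h | h
      · exact ⟨0, h 0⟩
      · exact ⟨2, h 2⟩
    obtain ⟨c, hc⟩ := key x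
    obtain ⟨c', hc'⟩ := key x'
    have := f.injective (hc.trans ((congrArg (fun y => Dart.cross y 0) hx).trans hc'.symm))
    exact (Dart.cross.inj this).1
  have hsurj : Function.Surjective g := by
    intro y
    have h1 : (f.symm (cross y 1)).IsOver := by
      rw [← ho, Equiv.apply_symm_apply]; exact Or.inl rfl
    rcases hf : f.symm (cross y 1) with ⟨x, s⟩ | ⟨q, b⟩ | i
    · rw [Equiv.symm_apply_eq] at hf
      refine ⟨x, ?_⟩
      rcases hg x with h | h
      · exact (Dart.cross.inj (hf.trans (h s))).1.symm
      · exact (Dart.cross.inj (hf.trans (h s))).1.symm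
    · rw [hf] at h1; exact h1.elim
    · exact i.elim0
  exact ⟨Equiv.ofBijective g ⟨hinj, hsurj⟩, hg⟩

theorem Iso.exists_mark {S T : Tangle 0} {f : S.D ≃ T.D} {g : S.X ≃ T.X}
    (hg : ∀ x, (∀ c, f (Dart.cross x c) = Dart.cross (g x) c) ∨
      ∀ c, f (Dart.cross x c) = Dart.cross (g x) (c + 2)) (p : S.P) (b : Bool) :
    ∃ q b', f (Dart.mark p b) = Dart.mark q b' := by
  rcases hf : f (Dart.mark p b) with ⟨y, s⟩ | ⟨q, b'⟩ | i
  · exfalso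
    obtain ⟨x, rfl⟩ := g.surjective y
    rcases hg x with h | h
    · have := f.injective (hf.trans (h s).symm)
      cases this
    · have h2 := h (s + 2)
      rw [add_assoc, show (2 : Fin 4) + 2 = 0 from rfl, add_zero] at h2
      have := f.injective (hf.trans h2.symm)
      cases this
  · exact ⟨q, b', rfl⟩
  · exact i.elim0

theorem smoothing_add_two {X : Type} (s : X → Bool) (x : X) (c : Fin 4) :
    smoothing s x (c + 2) = smoothing s x c + 2 := by
  unfold smoothing
  cases s x <;> revert c <;> decide

theorem Iso.bracket_eq {S T : Tangle 0} (h : S.Iso T) : S.bracket A B = T.bracket A B := by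
  obtain ⟨f, hr, he, ho, -⟩ := h
  obtain ⟨g, hg⟩ := Iso.exists_equiv hr ho
  let := Fintype.ofFinite S.X
  let := Classical.decEq S.X
  let := Fintype.ofFinite T.X
  let := Classical.decEq T.X
  rw [bracket_eq_sum, bracket_eq_sum, ← (g.arrowCongr (Equiv.refl Bool)).sum_comp]
  refine Finset.sum_congr rfl fun s _ => ?_
  have hs : (g.arrowCongr (Equiv.refl Bool)) s = s ∘ g.symm := rfl
  have h1 : stateWeight A B (s ∘ g.symm) = stateWeight A B s := by
    unfold stateWeight
    exact g.symm.prod_comp fun x => if s x then A else B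
  have h2 : ∀ d, f (reconnect (smoothing s) d) = reconnect (smoothing (s ∘ g.symm)) (f d) := by
    have hsm : ∀ x, smoothing (s ∘ g.symm) (g x) = smoothing s x := fun x => by
      funext c; simp [smoothing]
    rintro (⟨x, c⟩ | ⟨p, b⟩ | i)
    · rcases hg x with h | h
      · simp only [reconnect, h, hsm]
      · simp only [reconnect, h, hsm, smoothing_add_two]
    · obtain ⟨q, b', h⟩ := Iso.exists_mark hg p b
      have := hr (Dart.mark p b)
      rw [h] at this ⊢
      exact this
    · exact i.elim0
  rw [hs, h1]
  congr 2
  refine Nat.card_congr (Quot.congr f fun d e => ?_)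
  rw [← h2, ← he, f.injective.eq_iff, f.injective.eq_iff]

theorem IsOrientation.iso {S T : Tangle 0} (h : S.Iso T) {o : T.D → Bool}
    (ho : T.IsOrientation o) : ∃ o' : S.D → Bool, S.IsOrientation o' ∧
      ∀ A B : R, S.jones o' A B = T.jones o A B := by
  have hb := fun A B : R => h.bracket_eq (A := A) (B := B)
  obtain ⟨f, hr, he, hov, -⟩ := h
  obtain ⟨g, hg⟩ := Iso.exists_equiv hr hov
  refine ⟨fun d => o (f d), ⟨fun x c => ?_, fun p b => ?_, fun d => ?_⟩, fun A B => ?_⟩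
  · rcases hg x with h | h <;> rw [h, h, ho.cross]
  · obtain ⟨q, b', h⟩ := Iso.exists_mark hg p b
    have := hr (Dart.mark p b)
    rw [h] at this
    rw [h, ← ho.mark]
    exact congrArg o this
  · rw [he, ho.edge]
  · unfold jones
    rw [hb]
    congr 1
    let := Fintype.ofFinite S.X
    let := Fintype.ofFinite T.X
    rw [writheFactor_eq_prod, writheFactor_eq_prod, ← g.prod_comp]
    refine Finset.prod_congr rfl fun x _ => ?_
    rcases hg x with h | h
    · rw [h, h]
    · rw [h, h, ho.cross, ho.cross]
      congr 1
      simp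

/-! ### Subdivision, mirror images and unlinks -/

theorem card_loops_subdivide (T : Tangle 0) (d : T.D) (ρ : T.X → Fin 4 → Fin 4) :
    Nat.card ((T.subdivide d).Loops ρ) = Nat.card (T.Loops ρ) := by
  let m : T.D → T.Loops ρ := Quot.mk _
  have m_rec : ∀ d, m (reconnect ρ d) = m d := fun d => by symm; exact Quot.sound (Or.inl rfl)
  have m_edge : ∀ d, m (T.edge d) = m d := fun d => by symm; exact Quot.sound (Or.inr rfl)
  let g : Dart T.X (Option T.P) 0 → (T.subdivide d).Loops ρ := Quot.mk _
  have g_rec : ∀ d, g (reconnect ρ d) = g d := fun d => by symm; exact Quot.sound (Or.inl rfl)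
  have g_edge : ∀ e, g (T.subdivideEdge d e) = g e := fun d => by
    symm; exact Quot.sound (Or.inr rfl)
  let φ : Dart T.X (Option T.P) 0 → T.Loops ρ
    | cross x c => m (cross x c)
    | mark (some p) b => m (mark p b)
    | mark none _ => m d
  have φl : ∀ e, φ (lift e) = m e := by
    rintro (_ | _ | i)
    · rfl
    · rfl
    · exact i.elim0
  have φcut : ∀ e, φ (T.cut d e) = m e := by
    intro e
    unfold cut
    split_ifs with h1 h2
    · subst h1; rfl
    · subst h2; exact (m_edge d).symm
    · rw [φl, m_edge]
  have φrec : ∀ e, φ (reconnect ρ e) = φ e := by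
    rintro (⟨x, c⟩ | ⟨_ | p, b⟩ | i)
    · exact m_rec (cross x c)
    · rfl
    · exact m_rec (mark p b)
    · exact i.elim0
  have φedge : ∀ e, φ (T.subdivideEdge d e) = φ e := by
    rintro (⟨x, c⟩ | ⟨_ | p, b⟩ | i)
    · exact φcut (cross x c)
    · cases b
      · exact φl d
      · exact (φl _).trans (m_edge d)
    · exact φcut (mark p b)
    · exact i.elim0
  have g_none : ∀ b, g (mark none b) = g (lift d) := by
    have h0 : g (mark none false) = g (lift d) := (g_edge (mark none false)).symm
    intro b
    cases b
    · exact h0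
    · exact (g_rec (mark none false)).trans h0
  have g_lift : ∀ e, g (lift (T.edge e)) = g (lift e) := by
    intro e
    have h := g_edge (lift e)
    rw [subdivideEdge_lift] at h
    unfold cut at h
    split_ifs at h with h1 h2
    · subst h1
      exact (g_edge (mark none true)).trans (g_none true)
    · subst h2
      rw [T.edge_edge, ← h, g_none]
    · exact h
  refine Nat.card_congr
    { toFun := Quot.lift φ ?_, invFun := Quot.lift (fun e => g (lift e)) ?_
      left_inv := ?_, right_inv := ?_ }
  · rintro a b (rfl | rfl)
    · exact (φrec a).symm
    · exact (φedge a).symm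
  · rintro a b (rfl | rfl)
    · rcases a with ⟨x, c⟩ | ⟨p, b⟩ | i
      · exact (g_rec (cross x c)).symm
      · exact (g_rec (mark (some p) b)).symm
      · exact i.elim0
    · exact (g_lift a).symm
  · rintro ⟨⟨x, c⟩ | ⟨_ | p, b⟩ | i⟩
    · rfl
    · exact (g_none b).symm
    · rfl
    · exact i.elim0
  · rintro ⟨e⟩
    exact φl e

theorem bracket_subdivide (T : Tangle 0) (d : T.D) :
    (T.subdivide d).bracket A B = T.bracket A B := by
  let := Fintype.ofFinite T.X
  let := Classical.decEq T.X
  rw [T.bracket_eq_sum]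
  refine ((T.subdivide d).bracket_eq_sum (i := inferInstanceAs (Fintype T.X))
    (j := inferInstanceAs (DecidableEq T.X)) A B).trans ?_
  exact Finset.sum_congr rfl fun (s : T.X → Bool) _ =>
    congrArg (fun m => stateWeight A B s * (-A ^ 2 - B ^ 2) ^ m)
      (card_loops_subdivide T d (smoothing s))

theorem isOrientation_subdivide (T : Tangle 0) (d : T.D) {o : Dart T.X (Option T.P) 0 → Bool}
    (ho : (T.subdivide d).IsOrientation o) : T.IsOrientation fun e => o (lift e) := by
  have hedge : ∀ e, o (T.subdivideEdge d e) = !o e := ho.edge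
  have h1 : o (lift d) = !o (mark none false) := hedge (mark none false)
  have h2 : o (lift (T.edge d)) = !o (mark none true) := hedge (mark none true)
  have h3 : o (mark none true) = !o (mark none false) := ho.mark none false
  refine ⟨fun x c => ho.cross x c, fun p b => ho.mark (some p) b, fun e => ?_⟩
  have h := hedge (lift e)
  rw [subdivideEdge_lift] at h
  unfold cut at h
  split_ifs at h with h1' h2'
  · subst h1'
    rw [h1, h2, h3]
  · subst h2'
    rw [T.edge_edge, h1, h2, h3, Bool.not_not]
  · exact h

theorem exists_isOrientation_subdivide (T : Tangle 0) (d : T.D) {o : T.D → Bool}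
    (ho : T.IsOrientation o) : ∃ o' : Dart T.X (Option T.P) 0 → Bool,
      (T.subdivide d).IsOrientation o' ∧ ∀ e, o' (lift e) = o e := by
  let o' : Dart T.X (Option T.P) 0 → Bool
    | cross x c => o (cross x c)
    | mark (some p) b => o (mark p b)
    | mark none b => b ^^ !o d
  have hl : ∀ e, o' (lift e) = o e := by
    rintro (_ | _ | i)
    · rfl
    · rfl
    · exact i.elim0
  have hn : ∀ b, o' (mark none b) = (b ^^ !o d) := fun _ => rfl
  have hcut : ∀ e, o' (T.cut d e) = !o e := by
    intro e
    unfold cut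
    split_ifs with h1 h2
    · subst h1; rw [hn]; simp
    · subst h2; rw [hn, ho.edge]; simp
    · rw [hl, ho.edge]
  have hedge : ∀ e, o' (T.subdivideEdge d e) = !o' e := by
    rintro (⟨x, c⟩ | ⟨_ | p, b⟩ | i)
    · exact hcut (cross x c)
    · cases b
      · change o' (lift d) = _
        rw [hl, hn]; simp
      · change o' (lift (T.edge d)) = _
        rw [hl, hn, ho.edge]; simp
    · exact hcut (mark p b)
    · exact i.elim0
  refine ⟨o', ⟨fun x c => ho.cross x c, ?_, hedge⟩, hl⟩
  rintro (_ | p) b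
  · change o' (mark none (!b)) = !o' (mark none b)
    rw [hn, hn]; cases b <;> simp
  · exact ho.mark p b

theorem jones_subdivide (T : Tangle 0) (d : T.D) {o : T.D → Bool}
    {o' : Dart T.X (Option T.P) 0 → Bool} (h : ∀ e, o' (lift e) = o e) :
    (T.subdivide d).jones o' A B = T.jones o A B := by
  unfold jones
  rw [bracket_subdivide]
  congr 1
  let := Fintype.ofFinite T.X
  rw [T.writheFactor_eq_prod]
  refine ((T.subdivide d).writheFactor_eq_prod (i := inferInstanceAs (Fintype T.X)) o' A B).trans ?_
  refine Finset.prod_congr rfl fun x _ => ?_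
  have h' : ∀ c, o' (cross x c) = o (cross x c) := fun c => h (cross x c)
  exact if_congr (by rw [← h', ← h']; rfl) rfl rfl

theorem bracket_mirror (T : Tangle 0) : T.mirror.bracket A B = T.bracket B A := by
  let := Fintype.ofFinite T.X
  let := Classical.decEq T.X
  rw [T.bracket_eq_sum]
  refine (T.mirror.bracket_eq_sum (i := inferInstanceAs (Fintype T.X))
    (j := inferInstanceAs (DecidableEq T.X)) A B).trans ?_
  refine Fintype.sum_equiv ((Equiv.refl T.X).arrowCongr Equiv.boolNot) _ _ fun s => ?_
  have h0 : ((Equiv.refl T.X).arrowCongr Equiv.boolNot) s = fun x => !s x := rfl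
  have h1 : stateWeight B A (fun x => !s x) = stateWeight A B s := by
    unfold stateWeight
    refine Finset.prod_congr rfl fun x _ => ?_
    cases h : s x <;> simp [h]
  have h2 : Nat.card (T.Loops (smoothing fun x => !s x)) =
      Nat.card (T.mirror.Loops (smoothing s)) := by
    symm
    refine Nat.card_congr (Quot.congr shift fun d e => or_congr ?_ ?_)
    · have : shift (reconnect (smoothing s) d) = reconnect (smoothing fun x => !s x) (shift d) := by
        rcases d with ⟨x, c⟩ | ⟨p, b⟩ | i
        · change cross x (smoothing s x c + 1) = cross x (smoothing (fun x => !s x) x (c + 1))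
          have : ∀ (b : Bool) (c : Fin 4),
              (if b then 1 else 3) - c + 1 = (if !b then 1 else 3) - (c + 1) := by decide
          exact congrArg (cross x) (this (s x) c)
        · rfl
        · rfl
      exact this ▸ shift.injective.eq_iff.symm
    · exact Equiv.eq_symm_apply shift
  rw [h0, h1, h2]
  congr 2
  ring

theorem IsOrientation.of_mirror {T : Tangle 0} {o : T.D → Bool}
    (ho : T.mirror.IsOrientation o) : T.IsOrientation fun d => o (shift.symm d) := by
  refine ⟨fun x c => ?_, fun p b => ho.mark p b, fun d => ?_⟩
  · have := ho.cross x (c - 1)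
    change o (Dart.cross x (c + 2 - 1)) = !o (Dart.cross x (c - 1))
    refine Eq.trans ?_ this
    congr 2
    exact (by decide : ∀ c : Fin 4, c + 2 - 1 = c - 1 + 2) c
  · have := ho.edge (shift.symm d)
    change o (shift.symm (T.edge (shift (shift.symm d)))) = _ at this
    rwa [Equiv.apply_symm_apply] at this

/-- Passing to the mirror image reverses the sign of each crossing. -/
theorem IsOrientation.jones_mirror {T : Tangle 0} {o : T.D → Bool}
    (ho : T.mirror.IsOrientation o) :
    T.mirror.jones o A B = T.jones (fun d => o (shift.symm d)) B A := by
  unfold jones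
  rw [bracket_mirror]
  congr 1
  let := Fintype.ofFinite T.X
  rw [T.writheFactor_eq_prod]
  refine (T.mirror.writheFactor_eq_prod (i := inferInstanceAs (Fintype T.X)) o A B).trans ?_
  refine Finset.prod_congr rfl fun x _ => ?_
  have h : o (Dart.cross x (0 + 2)) = !o (Dart.cross x 0) := ho.cross x 0
  change (if o (Dart.cross x 1) = o (Dart.cross x (0 + 2)) then _ else _) =
    if o (Dart.cross x 0) = o (Dart.cross x 1) then _ else _
  rw [h]
  cases o (Dart.cross x 0) <;> cases o (Dart.cross x 1) <;> simp

theorem bracket_circles (n : ℕ) : (circles n).bracket A B = (-A ^ 2 - B ^ 2) ^ n := by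
  refine ((circles n).bracket_eq_sum (i := inferInstanceAs (Fintype Empty))
    (j := inferInstanceAs (DecidableEq Empty)) A B).trans ?_
  have hc : ∀ ρ, Nat.card ((circles n).Loops ρ) = n := by
    intro ρ
    have e : (circles n).Loops ρ ≃ Fin n :=
      { toFun := Quot.lift (fun d => match d with
          | mark p _ => p) (by
            rintro (x | ⟨p, b⟩ | i) _ (rfl | rfl)
            · exact x.elim
            · exact x.elim
            · rfl
            · rfl
            · exact i.elim0
            · exact i.elim0)
        invFun := fun p => Quot.mk _ (mark p false)
        left_inv := by
          rintro ⟨x | ⟨p, b⟩ | i⟩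
          · exact x.elim
          · cases b
            · rfl
            · exact Quot.sound (Or.inl rfl)
          · exact i.elim0
        right_inv := fun _ => rfl }
    rw [Nat.card_congr e]; simp
  refine (Fintype.sum_unique (ι := Empty → Bool) _).trans ?_
  rw [hc]
  exact one_mul _

end Tangle

/-! ### Invariance under Reidemeister moves -/

namespace Tangle

variable {k : ℕ} {R : Type*} [CommRing R] {A B : R}

theorem IsOrientation.tip_of_glue {S T : Tangle k}
    {o : Dart (S.X ⊕ T.X) ((S.P ⊕ T.P) ⊕ Fin k) 0 → Bool} (ho : (S.glue T).IsOrientation o)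
    (i : Fin k) : o (inRight (tip i)) = !o (inLeft (tip i.rev)) :=
  ho.mark (Sum.inr i.rev) false

theorem IsOrientation.left_of_glue {S T : Tangle k}
    {o : Dart (S.X ⊕ T.X) ((S.P ⊕ T.P) ⊕ Fin k) 0 → Bool} (ho : (S.glue T).IsOrientation o) :
    S.IsOrientation fun d => o (inLeft d) where
  cross x c := ho.cross (Sum.inl x) c
  mark p b := ho.mark (Sum.inl (Sum.inl p)) b
  edge d := by
    rw [← glueEdge_inLeft]
    exact ho.edge (inLeft d)

theorem IsOrientation.right_of_glue {S T : Tangle k}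
    {o : Dart (S.X ⊕ T.X) ((S.P ⊕ T.P) ⊕ Fin k) 0 → Bool} (ho : (S.glue T).IsOrientation o) :
    T.IsOrientation fun d => o (inRight d) where
  cross x c := ho.cross (Sum.inr x) c
  mark p b := ho.mark (Sum.inl (Sum.inr p)) b
  edge d := by
    rw [← glueEdge_inRight]
    exact ho.edge (inRight d)

/-- Orientations of two tangles that match along the common boundary circle. -/
theorem IsOrientation.glue {S T : Tangle k} {o : S.D → Bool} {o' : T.D → Bool}
    (ho : S.IsOrientation o) (ho' : T.IsOrientation o')
    (h : ∀ i : Fin k, o' (tip i) = !o (tip i.rev)) :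
    ∃ o'' : Dart (S.X ⊕ T.X) ((S.P ⊕ T.P) ⊕ Fin k) 0 → Bool, (S.glue T).IsOrientation o'' ∧
      (∀ d, o'' (inLeft d) = o d) ∧ ∀ d, o'' (inRight d) = o' d := by
  let o'' : Dart (S.X ⊕ T.X) ((S.P ⊕ T.P) ⊕ Fin k) 0 → Bool
    | Dart.cross (Sum.inl x) c => o (Dart.cross x c)
    | Dart.cross (Sum.inr x) c => o' (Dart.cross x c)
    | Dart.mark (Sum.inl (Sum.inl p)) b => o (Dart.mark p b)
    | Dart.mark (Sum.inl (Sum.inr p)) b => o' (Dart.mark p b)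
    | Dart.mark (Sum.inr i) false => o (tip i)
    | Dart.mark (Sum.inr i) true => o' (tip i.rev)
  have hl : ∀ d, o'' (inLeft d) = o d := by rintro (_ | _ | _) <;> rfl
  have hr : ∀ d, o'' (inRight d) = o' d := by
    rintro (_ | _ | i)
    · rfl
    · rfl
    · change o' (tip i.rev.rev) = _
      rw [Fin.rev_rev]
  refine ⟨o'', ⟨?_, ?_, fun d => ?_⟩, hl, hr⟩
  · rintro (x | x) c
    · exact ho.cross x c
    · exact ho'.cross x c
  · have ht : ∀ i : Fin k, o' (tip i.rev) = !o (tip i) := fun i => by rw [h, Fin.rev_rev]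
    rintro ((p | p) | i) b
    · exact ho.mark p b
    · exact ho'.mark p b
    · cases b
      · exact ht i
      · change o (tip i) = !o' (tip i.rev)
        rw [ht, Bool.not_not]
  · change o'' (glueEdge S T d) = _
    rcases glue_cases S T d with ⟨e, rfl⟩ | ⟨e, rfl⟩
    · rw [glueEdge_inLeft, hl, hl, ho.edge]
    · rw [glueEdge_inRight, hr, hr, ho'.edge]

theorem writheFactor_glue (S T : Tangle k) (o : Dart (S.X ⊕ T.X) ((S.P ⊕ T.P) ⊕ Fin k) 0 → Bool) :
    (S.glue T).writheFactor o A B =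
      S.writheFactor (fun d => o (inLeft d)) A B * T.writheFactor (fun d => o (inRight d)) A B := by
  let := Fintype.ofFinite S.X
  let := Fintype.ofFinite T.X
  rw [S.writheFactor_eq_prod, T.writheFactor_eq_prod]
  refine ((S.glue T).writheFactor_eq_prod (i := inferInstanceAs (Fintype (S.X ⊕ T.X)))
    o A B).trans ?_
  exact Fintype.prod_sum_type _

/-- Every orientation of the tangle `T` can be replaced by one of `U` with the same ends, and the
change of the writhe then compensates for the change of the bracket. -/
def JonesReplaceable (R : Type*) [CommRing R] (T U : Tangle k) : Prop :=
  ∀ o : T.D → Bool, T.IsOrientation o → ∃ o' : U.D → Bool, U.IsOrientation o' ∧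
    (∀ i, o' (tip i) = o (tip i)) ∧ ∀ (S : Tangle k) (A B : R), A * B = 1 →
      T.writheFactor o A B * (S.glue T).bracket A B = U.writheFactor o' A B * (S.glue U).bracket A B

theorem JonesReplaceable.glue {T U : Tangle k} (h : JonesReplaceable R T U) (S : Tangle k)
    {o : Dart (S.X ⊕ T.X) ((S.P ⊕ T.P) ⊕ Fin k) 0 → Bool} (ho : (S.glue T).IsOrientation o) :
    ∃ o' : Dart (S.X ⊕ U.X) ((S.P ⊕ U.P) ⊕ Fin k) 0 → Bool, (S.glue U).IsOrientation o' ∧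
      ∀ A B : R, A * B = 1 → (S.glue T).jones o A B = (S.glue U).jones o' A B := by
  obtain ⟨oU, hoU, htip, hb⟩ := h _ ho.right_of_glue
  obtain ⟨o', ho', hl, hr⟩ := ho.left_of_glue.glue hoU fun i => by rw [htip, ho.tip_of_glue]
  refine ⟨o', ho', fun A B hAB => ?_⟩
  unfold jones
  rw [writheFactor_glue, writheFactor_glue, mul_assoc, mul_assoc, hb S A B hAB]
  simp only [hl, hr]

theorem IsOrientation.edges {T : Tangle k} {o : T.D → Bool} (ho : T.IsOrientation o)
    {d e : T.D} (h : T.edge d = e) : o e = !o d := h ▸ ho.edge d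

end Tangle

/-! ### Orientations of the tangles in the Reidemeister moves -/

namespace Tangle

variable {n k : ℕ} {R : Type*} [CommRing R] {A B : R}

/-- Follow the strand of `d` until it reaches an end, for at most `j` edges. -/
def followStrand (edge : Dart (Fin n) Empty k → Dart (Fin n) Empty k) :
    ℕ → Dart (Fin n) Empty k → Dart (Fin n) Empty k
  | 0, d => d
  | j + 1, d => followStrand edge j (straight (edge d))

/-- An orientation is determined by its values at one end of each strand. -/
theorem IsOrientation.eq_of_tips {l : List (Dart (Fin n) Empty k × Dart (Fin n) Empty k)}
    {h : ∀ d, partner l (partner l d) = d ∧ partner l d ≠ d} {o o' : Dart (Fin n) Empty k → Bool}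
    (ho : (ofPairs n k l h).IsOrientation o) (ho' : (ofPairs n k l h).IsOrientation o')
    (I : List (Fin k)) (htip : ∀ i ∈ I, o (tip i) = o' (tip i))
    (hI : ∀ d, ∃ j < 4 * n + 2, ∃ i ∈ I, followStrand (partner l) j d = tip i) : o = o' := by
  have hedge : ∀ d, o (partner l d) = o' (partner l d) → o d = o' d := by
    intro d hd
    have h1 : o (partner l d) = !o d := ho.edge d
    have h2 : o' (partner l d) = !o' d := ho'.edge d
    rw [h1, h2] at hd
    exact Bool.not_inj hd
  have hstraight : ∀ d, o (straight d) = o' (straight d) → o d = o' d := by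
    rintro (⟨x, c⟩ | ⟨p, b⟩ | i) hd
    · have h1 : o (straight (Dart.cross x c)) = !o (Dart.cross x c) := ho.cross x c
      have h2 : o' (straight (Dart.cross x c)) = !o' (Dart.cross x c) := ho'.cross x c
      rw [h1, h2] at hd
      exact Bool.not_inj hd
    · exact p.elim
    · exact hd
  have key : ∀ j d, o (followStrand (partner l) j d) = o' (followStrand (partner l) j d) →
      o d = o' d := by
    intro j
    induction j with
    | zero => exact fun d hd => hd
    | succ j ih => exact fun d hd => hedge d (hstraight _ (ih _ hd))
  funext d
  obtain ⟨j, -, i, hi, hd⟩ := hI d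
  exact key j d (by rw [hd, htip i hi])

/-- The orientation of `arc` with direction `t` at the end `0`. -/
def arcOrientation (t : Bool) : Dart (Fin 0) Empty 2 → Bool
  | tip i => ![t, !t] i

/-- The orientation of `kink a` with direction `t` at the end `0`. -/
def kinkOrientation (a t : Bool) : Dart (Fin 1) Empty 2 → Bool
  | tip i => ![t, !t] i
  | cross _ c => ![!t, t, t, !t] (if a then c - 1 else c)

/-- The orientation of `arcs` with directions `t`, `u` at the ends `0`, `3`. -/
def arcsOrientation (t u : Bool) : Dart (Fin 0) Empty 4 → Bool
  | tip i => ![t, !t, !u, u] i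

/-- The orientation of `pushed a` with directions `t`, `u` at the ends `0`, `3`. -/
def pushedOrientation (a t u : Bool) : Dart (Fin 2) Empty 4 → Bool
  | tip i => ![t, !t, !u, u] i
  | cross x c => ![![!t, u, t, !u], ![!u, t, u, !t]] x (if a ^^ (x == 1) then c - 1 else c)

/-- The orientation of `overBelow a` and of `overAbove a` with directions `t`, `u`, `v` at the ends
`0`, `1`, `2`. -/
def overOrientation (a t u v : Bool) : Dart (Fin 3) Empty 6 → Bool
  | tip i => ![t, u, v, !t, !u, !v] i
  | cross x c =>
    ![![u, !t, !u, t], ![v, !t, !v, t], ![!u, !v, u, v]] x (if a && (x == 2) then c - 1 else c)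

theorem isOrientation_arc (t : Bool) : arc.IsOrientation (arcOrientation t) where
  cross x := Fin.elim0 x
  mark p := Empty.elim p
  edge := by revert t; exact (by decide : ∀ t d,
    arcOrientation t (arcEdge d) = !arcOrientation t d)

theorem isOrientation_kink (a t : Bool) : (kink a).IsOrientation (kinkOrientation a t) where
  cross := by revert a t; exact (by decide : ∀ a t (x : Fin 1) (c : Fin 4),
    kinkOrientation a t (cross x (c + 2)) = !kinkOrientation a t (cross x c))
  mark p := Empty.elim p
  edge := by revert a t; exact (by decide : ∀ a t d,
    kinkOrientation a t (kinkEdge a d) = !kinkOrientation a t d)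

theorem isOrientation_arcs (t u : Bool) : arcs.IsOrientation (arcsOrientation t u) where
  cross x := Fin.elim0 x
  mark p := Empty.elim p
  edge := by revert t u; exact (by decide : ∀ t u d,
    arcsOrientation t u (arcsEdge d) = !arcsOrientation t u d)

theorem isOrientation_pushed (a t u : Bool) :
    (pushed a).IsOrientation (pushedOrientation a t u) where
  cross := by revert a t u; exact (by decide : ∀ a t u (x : Fin 2) (c : Fin 4),
    pushedOrientation a t u (cross x (c + 2)) = !pushedOrientation a t u (cross x c))
  mark p := Empty.elim p
  edge := by revert a t u; exact (by decide +kernel : ∀ a t u d,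
    pushedOrientation a t u (pushedEdge a d) = !pushedOrientation a t u d)

theorem overOrientation_cross : ∀ a t u v (x : Fin 3) (c : Fin 4),
    overOrientation a t u v (cross x (c + 2)) = !overOrientation a t u v (cross x c) := by
  decide +kernel

theorem isOrientation_overBelow (a t u v : Bool) :
    (overBelow a).IsOrientation (overOrientation a t u v) where
  cross := overOrientation_cross a t u v
  mark p := Empty.elim p
  edge := by revert a t u v; exact (by decide +kernel : ∀ a t u v d,
    overOrientation a t u v (overBelowEdge a d) = !overOrientation a t u v d)

theorem isOrientation_overAbove (a t u v : Bool) :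
    (overAbove a).IsOrientation (overOrientation a t u v) where
  cross := overOrientation_cross a t u v
  mark p := Empty.elim p
  edge := by revert a t u v; exact (by decide +kernel : ∀ a t u v d,
    overOrientation a t u v (overAboveEdge a d) = !overOrientation a t u v d)

theorem IsOrientation.eq_arc {o : Dart (Fin 0) Empty 2 → Bool} (ho : arc.IsOrientation o) :
    o = arcOrientation (o (tip 0)) :=
  ho.eq_of_tips (isOrientation_arc _) [0] (by simp [arcOrientation])
    (by decide : ∀ d, ∃ j < 2, ∃ i ∈ [0], followStrand arcEdge j d = tip i)

theorem IsOrientation.eq_kink {a : Bool} {o : Dart (Fin 1) Empty 2 → Bool}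
    (ho : (kink a).IsOrientation o) : o = kinkOrientation a (o (tip 0)) :=
  ho.eq_of_tips (isOrientation_kink a _) [0] (by simp [kinkOrientation])
    ((by decide +kernel : ∀ a d, ∃ j < 6, ∃ i ∈ [0], followStrand (kinkEdge a) j d = tip i) a)

theorem IsOrientation.eq_arcs {o : Dart (Fin 0) Empty 4 → Bool} (ho : arcs.IsOrientation o) :
    o = arcsOrientation (o (tip 0)) (o (tip 3)) :=
  ho.eq_of_tips (isOrientation_arcs _ _) [0, 3] (by simp [arcsOrientation])
    (by decide : ∀ d, ∃ j < 2, ∃ i ∈ [0, 3], followStrand arcsEdge j d = tip i)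

theorem IsOrientation.eq_pushed {a : Bool} {o : Dart (Fin 2) Empty 4 → Bool}
    (ho : (pushed a).IsOrientation o) : o = pushedOrientation a (o (tip 0)) (o (tip 3)) :=
  ho.eq_of_tips (isOrientation_pushed a _ _) [0, 3] (by simp [pushedOrientation])
    ((by decide +kernel :
      ∀ a d, ∃ j < 10, ∃ i ∈ [0, 3], followStrand (pushedEdge a) j d = tip i) a)

theorem IsOrientation.eq_overBelow {a : Bool} {o : Dart (Fin 3) Empty 6 → Bool}
    (ho : (overBelow a).IsOrientation o) :
    o = overOrientation a (o (tip 0)) (o (tip 1)) (o (tip 2)) :=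
  ho.eq_of_tips (isOrientation_overBelow a _ _ _) [0, 1, 2] (by simp [overOrientation])
    ((by decide +kernel :
      ∀ a d, ∃ j < 14, ∃ i ∈ [0, 1, 2], followStrand (overBelowEdge a) j d = tip i) a)

theorem IsOrientation.eq_overAbove {a : Bool} {o : Dart (Fin 3) Empty 6 → Bool}
    (ho : (overAbove a).IsOrientation o) :
    o = overOrientation a (o (tip 0)) (o (tip 1)) (o (tip 2)) :=
  ho.eq_of_tips (isOrientation_overAbove a _ _ _) [0, 1, 2] (by simp [overOrientation])
    ((by decide +kernel :
      ∀ a d, ∃ j < 14, ∃ i ∈ [0, 1, 2], followStrand (overAboveEdge a) j d = tip i) a)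

theorem writheFactor_arc (o : Dart (Fin 0) Empty 2 → Bool) : arc.writheFactor o A B = 1 :=
  (arc.writheFactor_eq_prod (i := inferInstanceAs (Fintype (Fin 0))) o A B).trans
    (Fin.prod_univ_zero _)

theorem writheFactor_arcs (o : Dart (Fin 0) Empty 4 → Bool) : arcs.writheFactor o A B = 1 :=
  (arcs.writheFactor_eq_prod (i := inferInstanceAs (Fintype (Fin 0))) o A B).trans
    (Fin.prod_univ_zero _)

theorem writheFactor_kink (a t : Bool) :
    (kink a).writheFactor (kinkOrientation a t) A B = if a then -A ^ 3 else -B ^ 3 := by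
  refine ((kink a).writheFactor_eq_prod (i := inferInstanceAs (Fintype (Fin 1))) _ A B).trans ?_
  refine (Fin.prod_univ_one _).trans ?_
  cases a <;> cases t <;> rfl

theorem writheFactor_pushed (a t u : Bool) (h : A * B = 1) :
    (pushed a).writheFactor (pushedOrientation a t u) A B = 1 := by
  refine ((pushed a).writheFactor_eq_prod (i := inferInstanceAs (Fintype (Fin 2))) _ A B).trans ?_
  refine (Fin.prod_univ_two _).trans ?_
  have h1 : -A ^ 3 * -B ^ 3 = 1 := by rw [neg_mul_neg, ← mul_pow, h, one_pow]
  have h2 : -B ^ 3 * -A ^ 3 = 1 := by rw [mul_comm, h1]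
  cases a <;> cases t <;> cases u <;> first | exact h1 | exact h2

theorem jonesReplaceable_arc_kink (a : Bool) : JonesReplaceable R arc (kink a) := by
  intro o ho
  rw [ho.eq_arc]
  refine ⟨_, isOrientation_kink a (o (tip 0)), fun i => rfl, fun S A B h => ?_⟩
  rw [writheFactor_arc, writheFactor_kink, bracket_kink S a h, ← mul_assoc]
  congr 1
  cases a <;> simp [← mul_pow, h, mul_comm B A]

theorem jonesReplaceable_kink_arc (a : Bool) : JonesReplaceable R (kink a) arc := by
  intro o ho
  rw [ho.eq_kink]
  refine ⟨_, isOrientation_arc (o (tip 0)), fun i => rfl, fun S A B h => ?_⟩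
  rw [writheFactor_arc, writheFactor_kink, bracket_kink S a h, ← mul_assoc]
  congr 1
  cases a <;> simp [← mul_pow, h, mul_comm B A]

theorem jonesReplaceable_arcs_pushed (a : Bool) : JonesReplaceable R arcs (pushed a) := by
  intro o ho
  rw [ho.eq_arcs]
  refine ⟨_, isOrientation_pushed a (o (tip 0)) (o (tip 3)), fun i => rfl, fun S A B h => ?_⟩
  rw [writheFactor_arcs, writheFactor_pushed a _ _ h, bracket_pushed S a h]

theorem jonesReplaceable_pushed_arcs (a : Bool) : JonesReplaceable R (pushed a) arcs := by
  intro o ho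
  rw [ho.eq_pushed]
  refine ⟨_, isOrientation_arcs (o (tip 0)) (o (tip 3)), fun i => rfl, fun S A B h => ?_⟩
  rw [writheFactor_arcs, writheFactor_pushed a _ _ h, bracket_pushed S a h]

theorem jonesReplaceable_overBelow_overAbove (a : Bool) :
    JonesReplaceable R (overBelow a) (overAbove a) := by
  intro o ho
  rw [ho.eq_overBelow]
  refine ⟨_, isOrientation_overAbove a (o (tip 0)) (o (tip 1)) (o (tip 2)), fun i => rfl,
    fun S A B h => ?_⟩
  rw [bracket_overBelow S a h]
  rfl

theorem jonesReplaceable_overAbove_overBelow (a : Bool) :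
    JonesReplaceable R (overAbove a) (overBelow a) := by
  intro o ho
  rw [ho.eq_overAbove]
  refine ⟨_, isOrientation_overBelow a (o (tip 0)) (o (tip 1)) (o (tip 2)), fun i => rfl,
    fun S A B h => ?_⟩
  rw [bracket_overBelow S a h]
  rfl

end Tangle

namespace LinkDiagram

variable (R : Type*) [CommRing R]

/-- Each orientation of `D` corresponds to an orientation of `E` with the same Jones polynomial. -/
def JonesLE (D E : Tangle 0) : Prop :=
  ∀ o : D.D → Bool, D.IsOrientation o → ∃ o' : E.D → Bool, E.IsOrientation o' ∧
    ∀ A B : R, A * B = 1 → D.jones o A B = E.jones o' A B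

variable {R}

theorem JonesLE.trans {D E F : Tangle 0} (h : JonesLE R D E) (h' : JonesLE R E F) :
    JonesLE R D F := by
  intro o ho
  obtain ⟨o1, ho1, h1⟩ := h o ho
  obtain ⟨o2, ho2, h2⟩ := h' o1 ho1
  exact ⟨o2, ho2, fun A B hAB => (h1 A B hAB).trans (h2 A B hAB)⟩

theorem jonesLE_of_iso {D E : Tangle 0} (h : D.Iso E) : JonesLE R D E := by
  intro o ho
  obtain ⟨o', ho', h'⟩ := ho.iso (R := R) h.symm
  exact ⟨o', ho', fun A B _ => (h' A B).symm⟩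

theorem jonesLE_of_localMove {k : ℕ} {T U : Tangle k} (h : Tangle.JonesReplaceable R T U)
    (h' : Tangle.JonesReplaceable R U T) {D E : LinkDiagram} (hDE : LocalMove T U D E) :
    JonesLE R D.toTangle E.toTangle ∧ JonesLE R E.toTangle D.toTangle := by
  obtain ⟨S, -, hD, hE⟩ := hDE
  have h1 : JonesLE R (S.glue T) (S.glue U) := fun o ho => h.glue S ho
  have h2 : JonesLE R (S.glue U) (S.glue T) := fun o ho => h'.glue S ho
  exact ⟨((jonesLE_of_iso hD).trans h1).trans (jonesLE_of_iso hE.symm),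
    ((jonesLE_of_iso hE).trans h2).trans (jonesLE_of_iso hD.symm)⟩

theorem jonesLE_of_reidemeisterMove {D E : LinkDiagram} (h : ReidemeisterMove D E) :
    JonesLE R D.toTangle E.toTangle ∧ JonesLE R E.toTangle D.toTangle := by
  cases h with
  | iso h => exact ⟨jonesLE_of_iso h, jonesLE_of_iso h.symm⟩
  | subdivide d h =>
    have h1 : JonesLE R D.toTangle (D.toTangle.subdivide d) := by
      intro o ho
      obtain ⟨o', ho', hl⟩ := D.toTangle.exists_isOrientation_subdivide d ho
      exact ⟨o', ho', fun A B _ => (D.toTangle.jones_subdivide d hl).symm⟩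
    have h2 : JonesLE R (D.toTangle.subdivide d) D.toTangle := by
      intro o ho
      exact ⟨_, D.toTangle.isOrientation_subdivide d ho, fun A B _ =>
        D.toTangle.jones_subdivide d fun _ => rfl⟩
    exact ⟨h1.trans (jonesLE_of_iso h.symm), (jonesLE_of_iso h).trans h2⟩
  | one a h =>
    exact jonesLE_of_localMove (Tangle.jonesReplaceable_arc_kink a)
      (Tangle.jonesReplaceable_kink_arc a) h
  | two a h =>
    exact jonesLE_of_localMove (Tangle.jonesReplaceable_arcs_pushed a)
      (Tangle.jonesReplaceable_pushed_arcs a) h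
  | three a h =>
    exact jonesLE_of_localMove (Tangle.jonesReplaceable_overBelow_overAbove a)
      (Tangle.jonesReplaceable_overAbove_overBelow a) h

/-- The Jones polynomial is an isotopy invariant of oriented links. -/
theorem jonesLE_of_isotopic {D E : LinkDiagram} (h : Isotopic D E) :
    JonesLE R D.toTangle E.toTangle ∧ JonesLE R E.toTangle D.toTangle := by
  induction h with
  | rel D E h => exact jonesLE_of_reidemeisterMove h
  | refl D => exact ⟨fun o ho => ⟨o, ho, fun _ _ _ => rfl⟩, fun o ho => ⟨o, ho, fun _ _ _ => rfl⟩⟩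
  | symm D E _ ih => exact ih.symm
  | trans D E F _ _ ih ih' => exact ⟨ih.1.trans ih'.1, ih'.2.trans ih.2⟩

/-! ### The bracket under 3-equivalence -/

theorem pow_twentyFour {A : R} (hA : A ^ 8 - A ^ 4 + 1 = 0) : A ^ 24 = 1 := by
  linear_combination (A ^ 16 + A ^ 12 - A ^ 4 - 1) * hA

/-- The brackets agree up to a power of `A ^ 3`, the same one for all primitive 24-th roots of
unity `A`. -/
def BracketAssociated (R : Type*) [CommRing R] (D E : Tangle 0) : Prop :=
  ∃ j : ℕ, ∀ A B : R, A * B = 1 → A ^ 8 - A ^ 4 + 1 = 0 →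
    D.bracket A B = A ^ (3 * j) * E.bracket A B

theorem BracketAssociated.symm {D E : Tangle 0} (h : BracketAssociated R D E) :
    BracketAssociated R E D := by
  obtain ⟨j, hj⟩ := h
  refine ⟨7 * j, fun A B hAB hA => ?_⟩
  rw [hj A B hAB hA, ← mul_assoc, ← pow_add, show 3 * (7 * j) + 3 * j = 24 * j by ring, pow_mul,
    pow_twentyFour hA, one_pow, one_mul]

theorem BracketAssociated.trans {D E F : Tangle 0} (h : BracketAssociated R D E)
    (h' : BracketAssociated R E F) : BracketAssociated R D F := by
  obtain ⟨j, hj⟩ := h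
  obtain ⟨l, hl⟩ := h'
  refine ⟨j + l, fun A B hAB hA => ?_⟩
  rw [hj A B hAB hA, hl A B hAB hA, mul_add, pow_add, mul_assoc]

theorem bracketAssociated_of_eq {D E : Tangle 0}
    (h : ∀ A B : R, A * B = 1 → D.bracket A B = E.bracket A B) : BracketAssociated R D E :=
  ⟨0, fun A B hAB _ => by rw [h A B hAB]; simp⟩

theorem bracketAssociated_of_localMove {k : ℕ} {T U : Tangle k}
    (h : ∀ S : Tangle k, BracketAssociated R (S.glue U) (S.glue T)) {D E : LinkDiagram}
    (hDE : LocalMove T U D E) : BracketAssociated R D.toTangle E.toTangle := by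
  obtain ⟨S, -, hD, hE⟩ := hDE
  exact ((bracketAssociated_of_eq fun A B _ => hD.bracket_eq).trans (h S).symm).trans
    (bracketAssociated_of_eq fun A B _ => hE.bracket_eq.symm)

theorem pow_twelve {A : R} (hA : A ^ 8 - A ^ 4 + 1 = 0) : A ^ 12 = -1 := by
  linear_combination (A ^ 4 + 1) * hA

theorem neg_cube {A : R} (hA : A ^ 8 - A ^ 4 + 1 = 0) : -A ^ 3 = A ^ (3 * 5) := by
  linear_combination -A ^ 3 * pow_twelve hA

theorem inv_cube {A B : R} (h : A * B = 1) (hA : A ^ 8 - A ^ 4 + 1 = 0) :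
    B ^ 3 = A ^ (3 * 7) := by
  have h3 : A ^ 3 * B ^ 3 = 1 := by rw [← mul_pow, h, one_pow]
  linear_combination A ^ 21 * h3 - B ^ 3 * pow_twentyFour hA

theorem neg_inv_cube {A B : R} (h : A * B = 1) (hA : A ^ 8 - A ^ 4 + 1 = 0) :
    -B ^ 3 = A ^ (3 * 3) := by
  linear_combination -inv_cube h hA - A ^ 9 * pow_twelve hA

theorem bracketAssociated_of_reidemeisterMove {D E : LinkDiagram} (h : ReidemeisterMove D E) :
    BracketAssociated R D.toTangle E.toTangle := by
  cases h with
  | iso h => exact bracketAssociated_of_eq fun A B _ => h.bracket_eq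
  | subdivide d h =>
    exact bracketAssociated_of_eq fun A B _ =>
      (D.toTangle.bracket_subdivide d).symm.trans h.bracket_eq.symm
  | one a h =>
    refine bracketAssociated_of_localMove (fun S => ⟨if a then 3 else 5, fun A B hAB hA => ?_⟩) h
    rw [Tangle.bracket_kink S a hAB, neg_inv_cube hAB hA, neg_cube hA]
    cases a <;> rfl
  | two a h =>
    exact bracketAssociated_of_localMove (fun S => bracketAssociated_of_eq fun A B hAB =>
      Tangle.bracket_pushed S a hAB) h
  | three a h =>
    exact bracketAssociated_of_localMove (fun S => bracketAssociated_of_eq fun A B hAB =>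
      (Tangle.bracket_overBelow S a hAB).symm) h

theorem bracketAssociated_of_threeMove {D E : LinkDiagram} (h : ThreeMove D E) :
    BracketAssociated R D.toTangle E.toTangle := by
  obtain ⟨a, h⟩ := h
  refine bracketAssociated_of_localMove (fun S => ⟨if a then 7 else 1, fun A B hAB hA => ?_⟩) h
  rw [Tangle.bracket_threeTwists S a hAB hA, inv_cube hAB hA]
  cases a <;> rfl

theorem bracketAssociated_of_threeEquivalent {D E : LinkDiagram} (h : ThreeEquivalent D E) :
    BracketAssociated R D.toTangle E.toTangle := by
  induction h with
  | rel D E h =>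
    exact h.elim bracketAssociated_of_reidemeisterMove bracketAssociated_of_threeMove
  | refl D => exact bracketAssociated_of_eq fun _ _ _ => rfl
  | symm D E _ ih => exact ih.symm
  | trans D E F _ _ ih ih' => exact ih.trans ih'

end LinkDiagram

/-! ### Orbits of two involutions -/

section Involutions

variable {D : Type*} {a b : D → D}

/-- The composition `b ∘ a` of two involutions, as a permutation. -/
def involutionsPerm (ha : Function.Involutive a) (hb : Function.Involutive b) : Equiv.Perm D :=
  ha.toPerm.trans hb.toPerm

theorem involutionsPerm_zpow_comm (ha : Function.Involutive a) (hb : Function.Involutive b)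
    (n : ℤ) (d : D) :
    a ((involutionsPerm ha hb ^ n) d) = (involutionsPerm ha hb ^ (-n)) (a d) := by
  have h : ha.toPerm * involutionsPerm ha hb * ha.toPerm⁻¹ = (involutionsPerm ha hb)⁻¹ := by
    refine eq_inv_of_mul_eq_one_left (Equiv.ext fun d => ?_)
    change a (b (a (a (b (a d))))) = d
    rw [ha, hb, ha]
  rw [zpow_neg, ← inv_zpow, ← h, conj_zpow]
  change _ = a _
  congr 2
  exact (ha d).symm

/-- If two involutions have no fixed points, the orbits of their composition come in pairs. -/
theorem not_sameCycle_involutionsPerm (ha : Function.Involutive a) (hb : Function.Involutive b)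
    (ha' : ∀ d, a d ≠ d) (hb' : ∀ d, b d ≠ d) (d : D) :
    ¬ (involutionsPerm ha hb).SameCycle d (a d) := by
  rintro ⟨n, hn⟩
  set π := involutionsPerm ha hb with hπ
  obtain ⟨m, rfl | rfl⟩ := Int.even_or_odd' n
  · refine ha' ((π ^ m) d) ?_
    rw [involutionsPerm_zpow_comm ha hb, ← hn, ← hπ, ← Equiv.Perm.mul_apply, ← zpow_add]
    congr 2; ring
  · refine hb' (a ((π ^ m) d)) ?_
    change π ((π ^ m) d) = _
    rw [involutionsPerm_zpow_comm ha hb, ← hn, ← hπ, ← Equiv.Perm.mul_apply, ← Equiv.Perm.mul_apply,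
      ← zpow_add, ← zpow_one_add]
    congr 2; ring

/-- Two involutions without fixed points can be oriented simultaneously. -/
theorem exists_flip_of_involutive (ha : Function.Involutive a) (hb : Function.Involutive b)
    (ha' : ∀ d, a d ≠ d) (hb' : ∀ d, b d ≠ d) :
    ∃ o : D → Bool, (∀ d, o (a d) = !o d) ∧ ∀ d, o (b d) = !o d := by
  classical
  set π := involutionsPerm ha hb with hπ
  let m : D → Quot fun d e => e = a d ∨ e = b d := Quot.mk _
  have m_a : ∀ d, m (a d) = m d := fun d => by symm; exact Quot.sound (Or.inl rfl)
  have m_b : ∀ d, m (b d) = m d := fun d => by symm; exact Quot.sound (Or.inr rfl)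
  have hab : ∀ d, π.SameCycle (a d) (b d) := fun d => by
    refine ⟨1, ?_⟩
    rw [zpow_one]
    change b (a (a d)) = b d
    rw [ha]
  have haa : ∀ d e, π.SameCycle d e → π.SameCycle (a d) (a e) := by
    rintro d _ ⟨n, rfl⟩
    exact ⟨-n, by rw [hπ, involutionsPerm_zpow_comm ha hb]⟩
  -- the darts in the orbit of `r` under both involutions
  have hor : ∀ d e, m d = m e → π.SameCycle d e ∨ π.SameCycle (a d) e := by
    intro d e h
    let f : (Quot fun d e => e = a d ∨ e = b d) → Prop :=
      Quot.lift (fun e => π.SameCycle d e ∨ π.SameCycle (a d) e) (by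
        have step : ∀ e, (π.SameCycle d e ∨ π.SameCycle (a d) e) →
            (π.SameCycle d (a e) ∨ π.SameCycle (a d) (a e)) := by
          rintro e (h | h)
          · exact Or.inr (haa _ _ h)
          · have := haa _ _ h
            rw [ha] at this
            exact Or.inl this
        rintro x y (rfl | rfl)
        · refine propext ⟨step x, fun h => ?_⟩
          have := step _ h
          rwa [ha] at this
        · refine propext ⟨fun h => ?_, fun h => ?_⟩
          · exact (step x h).imp (·.trans (hab x)) (·.trans (hab x))
          · have := step _ (h.imp (·.trans (hab x).symm) (·.trans (hab x).symm))
            rwa [ha] at this)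
    have h1 : f (m d) := Or.inl (Equiv.Perm.SameCycle.refl _ _)
    rw [h] at h1
    exact h1
  let r : D → D := fun d => (m d).out
  have hr : ∀ d, m (r d) = m d := fun d => Quot.out_eq _
  have hra : ∀ d, r (a d) = r d := fun d => by simp only [r, m_a]
  have hrb : ∀ d, r (b d) = r d := fun d => by simp only [r, m_b]
  have hflip : ∀ d, π.SameCycle (a d) (r d) ↔ ¬ π.SameCycle d (r d) := by
    intro d
    refine ⟨fun h h' => not_sameCycle_involutionsPerm ha hb ha' hb' d (h'.trans h.symm),
      fun h => ?_⟩
    exact (hor d (r d) (hr d).symm).resolve_left h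
  refine ⟨fun d => decide (π.SameCycle d (r d)), fun d => ?_, fun d => ?_⟩
  · beta_reduce
    rw [hra, ← decide_not]
    exact decide_eq_decide.2 (hflip d)
  · beta_reduce
    rw [hrb, ← decide_not]
    refine decide_eq_decide.2 ((?_ : _ ↔ _).trans (hflip d))
    exact ⟨fun h => (hab d).trans h, fun h => (hab d).symm.trans h⟩

/-- The composition `b ∘ a` on the elements marked by `o`, if both involutions flip `o`. -/
def flipPerm (ha : Function.Involutive a) (hb : Function.Involutive b) {o : D → Bool}
    (hao : ∀ d, o (a d) = !o d) (hbo : ∀ d, o (b d) = !o d) : Equiv.Perm {d // o d = true} where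
  toFun d := ⟨b (a d), by rw [hbo, hao, Bool.not_not]; exact d.2⟩
  invFun d := ⟨a (b d), by rw [hao, hbo, Bool.not_not]; exact d.2⟩
  left_inv d := Subtype.ext (by simp [hb _, ha _])
  right_inv d := Subtype.ext (by simp [hb _, ha _])

/-- The orbits of two involutions that flip `o` are the cycles of their composition on one half of
the set. -/
theorem card_quot_eq_card_cycles (ha : Function.Involutive a) (hb : Function.Involutive b)
    {o : D → Bool} (hao : ∀ d, o (a d) = !o d) (hbo : ∀ d, o (b d) = !o d) :
    Nat.card (Quot fun d e => e = a d ∨ e = b d) =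
      Nat.card (Quotient (Equiv.Perm.SameCycle.setoid (flipPerm ha hb hao hbo))) := by
  set π := flipPerm ha hb hao hbo with hπ
  let q : {d // o d = true} → Quotient (Equiv.Perm.SameCycle.setoid π) := Quotient.mk _
  have q_π : ∀ d, q (π d) = q d := fun d => Quotient.sound ⟨-1, by simp⟩
  let φ : D → Quotient (Equiv.Perm.SameCycle.setoid π) := fun d =>
    if h : o d = true then q ⟨d, h⟩ else q ⟨a d, by simpa [hao] using h⟩
  have φ_pos : ∀ d (h : o d = true), φ d = q ⟨d, h⟩ := fun d h => dif_pos h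
  have φ_neg : ∀ d (h : o d = true), φ (a d) = q ⟨d, h⟩ := fun d h => by
    have h' : ¬ o (a d) = true := by simp [hao, h]
    simp only [φ, dif_neg h']
    congr 1
    exact Subtype.ext (ha d)
  have φ_a : ∀ d, φ (a d) = φ d := by
    intro d
    by_cases h : o d = true
    · rw [φ_neg d h, φ_pos d h]
    · have h' : o (a d) = true := by simpa [hao] using h
      have := φ_neg (a d) h'
      rw [ha] at this
      rw [this, φ_pos _ h']
  have φ_ba : ∀ d, o d = true → φ (b (a d)) = φ d := by
    intro d h
    have h' : o (b (a d)) = true := by simp [hao, hbo, h]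
    rw [φ_pos _ h', φ_pos _ h]
    exact q_π ⟨d, h⟩
  have φ_b : ∀ d, φ (b d) = φ d := by
    intro d
    by_cases h : o d = true
    · have h' : o (a (b d)) = true := by simp [hao, hbo, h]
      have := φ_ba _ h'
      rw [ha, hb, φ_a] at this
      exact this.symm
    · have h' : o (a d) = true := by simpa [hao] using h
      have := φ_ba _ h'
      rw [ha, φ_a] at this
      exact this
  refine Nat.card_congr
    { toFun := Quot.lift φ ?_
      invFun := Quotient.lift (fun d => Quot.mk _ d.1) ?_
      left_inv := ?_, right_inv := ?_ }
  · rintro x y (rfl | rfl)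
    · exact (φ_a x).symm
    · exact (φ_b x).symm
  · let m : D → Quot fun d e => e = a d ∨ e = b d := Quot.mk _
    have hm : ∀ d : {d // o d = true}, m (π d).1 = m d.1 := fun d => by
      have m_a : m (a d) = m d := by symm; exact Quot.sound (Or.inl rfl)
      have m_b : m (b (a d)) = m (a d) := by symm; exact Quot.sound (Or.inr rfl)
      exact m_b.trans m_a
    have hm' : ∀ (n : ℤ) (d : {d // o d = true}), m ((π ^ n) d).1 = m d.1 := by
      intro n
      induction n using Int.induction_on with
      | zero => exact fun _ => rfl
      | succ n ih => exact fun d => by rw [zpow_add_one, Equiv.Perm.mul_apply, ih, hm]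
      | pred n ih =>
        intro d
        rw [zpow_sub_one, Equiv.Perm.mul_apply, ih, ← hm]
        congr 2
        exact π.apply_symm_apply d
    rintro d _ ⟨n, rfl⟩
    exact (hm' n d).symm
  · rintro ⟨d⟩
    change Quotient.lift _ _ (φ d) = _
    by_cases h : o d = true
    · rw [φ_pos d h]; rfl
    · have h' : o (a d) = true := by simpa [hao] using h
      have := φ_neg _ h'
      rw [ha] at this
      rw [this]
      symm
      exact Quot.sound (Or.inl rfl)
  · rintro ⟨d⟩
    exact φ_pos d.1 d.2

/-- The sign of a permutation through the number of all its cycles, including the fixed points. -/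
theorem sign_eq_neg_one_pow {α : Type*} [Fintype α] [DecidableEq α] (f : Equiv.Perm α) :
    (Equiv.Perm.sign f : ℤ) =
      (-1) ^ (Fintype.card α + Nat.card (Quotient (Equiv.Perm.SameCycle.setoid f))) := by
  have e : Quotient (Equiv.Perm.SameCycle.setoid f) ≃
      {c // c ∈ f.cycleFactorsFinset} ⊕ {x // x ∉ f.support} := by
    refine Equiv.ofBijective (Quotient.lift (fun x =>
      if h : x ∈ f.support then
        Sum.inl ⟨f.cycleOf x, Equiv.Perm.cycleOf_mem_cycleFactorsFinset_iff.2 h⟩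
      else Sum.inr ⟨x, h⟩) ?_) ⟨?_, ?_⟩
    · intro x y h
      have hxy : f.SameCycle x y := h
      by_cases hx : x ∈ f.support
      · have hy : y ∈ f.support := by
          rw [Equiv.Perm.mem_support] at hx ⊢
          exact fun hy => hx (hxy.apply_eq_self_iff.2 hy)
        simp only [dif_pos hx, dif_pos hy, hxy.cycleOf_eq]
      · have hfx : f x = x := by simpa using hx
        obtain ⟨n, rfl⟩ := hxy
        rw [Equiv.Perm.zpow_apply_eq_self_of_apply_eq_self hfx]
    · rintro ⟨x⟩ ⟨y⟩ h
      change (if h : x ∈ f.support then _ else _) = (if h : y ∈ f.support then _ else _) at h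
      apply Quotient.sound
      change f.SameCycle x y
      split_ifs at h with hx hy hy
      · exact (Equiv.Perm.sameCycle_iff_cycleOf_eq_of_mem_support hx hy).2
          (Subtype.ext_iff.1 (Sum.inl.inj h))
      · obtain rfl : x = y := Subtype.ext_iff.1 (Sum.inr.inj h)
        exact Equiv.Perm.SameCycle.refl _ _
    · rintro (⟨c, hc⟩ | ⟨x, hx⟩)
      · obtain ⟨x, hx⟩ := (Equiv.Perm.mem_cycleFactorsFinset_iff.1 hc).1.nonempty_support
        have hx' : x ∈ f.support := Equiv.Perm.mem_cycleFactorsFinset_support_le hc hx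
        refine ⟨Quotient.mk _ x, ?_⟩
        change (if h : x ∈ f.support then _ else _) = _
        rw [dif_pos hx']
        congr 2
        exact (Equiv.Perm.cycle_is_cycleOf hx hc).symm
      · refine ⟨Quotient.mk _ x, ?_⟩
        change (if h : x ∈ f.support then _ else _) = _
        rw [dif_neg hx]
  have h1 : Fintype.card {x // x ∉ f.support} + f.support.card = Fintype.card α := by
    rw [Fintype.card_subtype_compl, Fintype.card_coe]
    exact Nat.sub_add_cancel (Finset.card_le_univ _)
  have h2 : Multiset.card f.cycleType = f.cycleFactorsFinset.card := by
    rw [Equiv.Perm.cycleType_def, Multiset.card_map]; rfl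
  rw [Nat.card_congr e, Nat.card_eq_fintype_card, Fintype.card_sum, Fintype.card_coe, ← h1,
    Equiv.Perm.sign_of_cycleType, Equiv.Perm.sum_cycleType, h2]
  push_cast
  rw [show Fintype.card {x // x ∉ f.support} + f.support.card + (f.cycleFactorsFinset.card +
    Fintype.card {x // x ∉ f.support}) = f.support.card + f.cycleFactorsFinset.card +
      2 * Fintype.card {x // x ∉ f.support} by ring, pow_add _ _ (2 * _), pow_mul (-1 : ℤ) 2]
  simp

end Involutions

/-! ### The parity of the number of loops -/

namespace Tangle

/-- The three ways to join the darts at a crossing in pairs: straight on, and the smoothings. -/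
def pairing : Fin 3 → Fin 4 → Fin 4 := ![fun c => c + 2, fun c => 1 - c, fun c => 3 - c]

theorem pairing_involutive : ∀ i, Function.Involutive (pairing i) := by
  unfold Function.Involutive; decide

theorem straight_eq_reconnect_pairing {X P : Type} {k : ℕ} :
    (straight : Dart X P k → Dart X P k) = reconnect fun _ => pairing 0 :=
  straight_eq_reconnect

theorem smoothing_eq_pairing {X : Type} (s : X → Bool) :
    smoothing s = fun x => pairing (if s x then 1 else 2) := by
  funext x c
  unfold smoothing
  cases s x <;> rfl

theorem reconnect_involutive {X P : Type} {k : ℕ} (ι : X → Fin 3) :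
    Function.Involutive (reconnect (fun x => pairing (ι x)) : Dart X P k → Dart X P k) := by
  rintro (⟨x, c⟩ | ⟨p, b⟩ | i)
  · exact congrArg (cross x) (pairing_involutive _ c)
  · exact congrArg (mark p) (Bool.not_not b)
  · rfl

/-- If two pairings at a crossing both join darts marked differently by `o`, they differ by the
exchange of the two marked darts. -/
theorem exists_pairing_swap : ∀ i j : Fin 3, i ≠ j → ∀ o : Fin 4 → Bool,
    (∀ c, o (pairing i c) = !o c) → (∀ c, o (pairing j c) = !o c) →
    ∃ c c', c ≠ c' ∧ o c = true ∧ o c' = true ∧ (∀ e, o e = true → e = c ∨ e = c') ∧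
      pairing j c = pairing i c' ∧ pairing j c' = pairing i c := by
  decide +kernel

variable {T : Tangle 0}

/-- When the pairing at one crossing is changed, compatibly with `o`, the number of
loops changes by an odd number. -/
theorem neg_one_pow_loops_update [DecidableEq T.X] {o : T.D → Bool} (ho : ∀ d, o (T.edge d) = !o d)
    (ι : T.X → Fin 3) (x : T.X) (j : Fin 3) (hj : ι x ≠ j)
    (h : ∀ d, o (reconnect (fun x => pairing (ι x)) d) = !o d)
    (h' : ∀ d, o (reconnect (fun y => pairing (Function.update ι x j y)) d) = !o d) :
    (-1 : ℤ) ^ Nat.card (T.Loops fun y => pairing (Function.update ι x j y)) =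
      -(-1) ^ Nat.card (T.Loops fun x => pairing (ι x)) := by
  classical
  let : Fintype {d : T.D // o d = true} := Fintype.ofFinite _
  have he : Function.Involutive T.edge := T.edge_edge
  have e1 := card_quot_eq_card_cycles (reconnect_involutive ι) he h ho
  have e2 := card_quot_eq_card_cycles (reconnect_involutive (Function.update ι x j)) he h' ho
  obtain ⟨c, c', hc, hoc, hoc', hall, h1, h2⟩ := exists_pairing_swap (ι x) j hj
    (fun c => o (cross x c)) (fun c => h (cross x c))
    (fun c => by have := h' (cross x c); simpa [reconnect] using this)
  have hswap : flipPerm (reconnect_involutive (Function.update ι x j)) he h' ho =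
      flipPerm (reconnect_involutive ι) he h ho *
        Equiv.swap ⟨cross x c, hoc⟩ ⟨cross x c', hoc'⟩ := by
    ext ⟨d, hd⟩ : 2
    rw [Equiv.Perm.mul_apply]
    by_cases hdc : d = cross x c
    · subst hdc
      rw [Equiv.swap_apply_left]
      refine congrArg T.edge (congrArg (cross x) ?_)
      beta_reduce
      rw [Function.update_self]; exact h1
    by_cases hdc' : d = cross x c'
    · subst hdc'
      rw [Equiv.swap_apply_right]
      refine congrArg T.edge (congrArg (cross x) ?_)
      beta_reduce
      rw [Function.update_self]; exact h2
    rw [Equiv.swap_apply_of_ne_of_ne (fun h => hdc (Subtype.ext_iff.1 h))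
      (fun h => hdc' (Subtype.ext_iff.1 h))]
    refine congrArg T.edge ?_
    rcases d with ⟨y, e⟩ | ⟨p, b⟩ | i
    · have hy : y ≠ x := by
        rintro rfl
        rcases hall e hd with rfl | rfl
        · exact hdc rfl
        · exact hdc' rfl
      refine congrArg (cross y) ?_
      beta_reduce
      rw [Function.update_of_ne hy]
    · rfl
    · rfl
  have hs := congrArg (fun f => (Equiv.Perm.sign f : ℤ)) hswap
  have hne : (⟨cross x c, hoc⟩ : {d : T.D // o d = true}) ≠ ⟨cross x c', hoc'⟩ := fun h =>
    hc (Dart.cross.inj (Subtype.ext_iff.1 h)).2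
  simp only [Equiv.Perm.sign_mul, Equiv.Perm.sign_swap hne, Units.val_neg, mul_neg, mul_one] at hs
  rw [sign_eq_neg_one_pow, sign_eq_neg_one_pow, ← e1, ← e2, pow_add, pow_add, ← mul_neg] at hs
  exact mul_left_cancel₀ (pow_ne_zero _ (by norm_num)) hs

/-- The numbers of loops for two choices of pairings that are compatible with `o` have the same
parity up to the number of crossings at which the choices differ. -/
theorem neg_one_pow_loops [Fintype T.X] {o : T.D → Bool} (ho : ∀ d, o (T.edge d) = !o d)
    (ι ι' : T.X → Fin 3)
    (h : ∀ d, o (reconnect (fun x => pairing (ι x)) d) = !o d)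
    (h' : ∀ d, o (reconnect (fun x => pairing (ι' x)) d) = !o d) :
    (-1 : ℤ) ^ Nat.card (T.Loops fun x => pairing (ι' x)) =
      (-1) ^ Nat.card (T.Loops fun x => pairing (ι x)) *
        ∏ x, if ι' x = ι x then 1 else -1 := by
  classical
  have hY : ∀ (Y : Finset T.X) (d : T.D),
      o (reconnect (fun x => pairing (Y.piecewise ι' ι x)) d) = !o d := by
    rintro Y (⟨x, c⟩ | ⟨p, b⟩ | i)
    · by_cases hx : x ∈ Y
      · have := h' (cross x c)
        simpa [reconnect, hx] using this
      · have := h (cross x c)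
        simpa [reconnect, hx] using this
    · exact h (mark p b)
    · exact i.elim0
  have key : ∀ Y : Finset T.X,
      (-1 : ℤ) ^ Nat.card (T.Loops fun x => pairing (Y.piecewise ι' ι x)) =
        (-1) ^ Nat.card (T.Loops fun x => pairing (ι x)) *
          ∏ x ∈ Y, if ι' x = ι x then 1 else -1 := by
    intro Y
    induction Y using Finset.induction_on with
    | empty => simp
    | insert x Y hx ih =>
      have hu : (insert x Y).piecewise ι' ι = Function.update (Y.piecewise ι' ι) x (ι' x) :=
        Finset.piecewise_insert _ _ _ _
      rw [Finset.prod_insert hx]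
      by_cases hxx : ι' x = ι x
      · have : (insert x Y).piecewise ι' ι = Y.piecewise ι' ι := by
          rw [hu, hxx]
          refine (congrArg (Function.update _ x) ?_).trans (Function.update_eq_self x _)
          simp [hx]
        rw [this, ih, if_pos hxx, one_mul]
      · have := neg_one_pow_loops_update ho (Y.piecewise ι' ι) x (ι' x)
          (by simpa [hx] using fun h => hxx h.symm) (hY Y) (hu ▸ hY (insert x Y))
        rw [hu, this, ih, if_neg hxx]
        ring
  have := key Finset.univ
  rwa [Finset.piecewise_univ] at this

/-! ### Alternating colourings of planar diagrams -/

open Module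

section Cochains

variable {D : Type} [Finite D] (r ε : D → D)

/-- The coboundary modulo 2 of a function on the orbits of `r`, at the edges `{d, ε d}`. -/
def coboundary (hε : ∀ d, ε (ε d) = d) :
    ((Quot fun d e : D => e = r d) → ZMod 2) →ₗ[ZMod 2]
      ((Quot fun d e : D => e = ε d) → ZMod 2) where
  toFun f := Quot.lift (fun d => f (Quot.mk _ d) + f (Quot.mk _ (ε d))) (by
    rintro d _ rfl
    rw [hε, add_comm])
  map_add' f g := by
    funext q
    obtain ⟨d, rfl⟩ := Quot.exists_rep q
    change f _ + g _ + (f _ + g _) = f _ + f _ + (g _ + g _)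
    ring
  map_smul' c f := by
    funext q
    obtain ⟨d, rfl⟩ := Quot.exists_rep q
    change c * f _ + c * f _ = c * (f _ + f _)
    ring

/-- The kernel of the coboundary consists of the functions that are constant on the components. -/
theorem finrank_range_coboundary (hε : ∀ d, ε (ε d) = d) :
    finrank (ZMod 2) (LinearMap.range (coboundary r ε hε)) +
      Nat.card (Quot fun d e : D => e = r d ∨ e = ε d) =
        Nat.card (Quot fun d e : D => e = r d) := by
  let p : (Quot fun d e : D => e = r d) → Quot fun d e : D => e = r d ∨ e = ε d :=
    Quot.map id fun d e h => Or.inl h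
  have hp : Function.Surjective p := by
    rintro ⟨d⟩
    exact ⟨Quot.mk _ d, rfl⟩
  have hker : LinearMap.ker (coboundary r ε hε) =
      LinearMap.range (LinearMap.funLeft (ZMod 2) (ZMod 2) p) := by
    ext f
    rw [LinearMap.mem_ker, LinearMap.mem_range]
    constructor
    · intro hf
      have hf' : ∀ d, f (Quot.mk _ d) = f (Quot.mk _ (ε d)) := fun d =>
        CharTwo.add_eq_zero.1 (congrFun hf (Quot.mk _ d))
      refine ⟨Quot.lift (fun d => f (Quot.mk _ d)) ?_, ?_⟩
      · rintro d _ (rfl | rfl)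
        · exact congrArg f (Quot.sound rfl)
        · exact hf' d
      · funext q
        obtain ⟨d, rfl⟩ := Quot.exists_rep q
        rfl
    · rintro ⟨f, rfl⟩
      funext q
      obtain ⟨d, rfl⟩ := Quot.exists_rep q
      refine CharTwo.add_eq_zero.2 (congrArg f ?_)
      exact Quot.sound (Or.inr rfl)
  have h1 := LinearMap.finrank_range_add_finrank_ker (coboundary r ε hε)
  have h2 := LinearMap.finrank_range_of_inj
    (LinearMap.funLeft_injective_of_surjective (ZMod 2) (ZMod 2) p hp)
  let := Fintype.ofFinite (Quot fun d e : D => e = r d)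
  let := Fintype.ofFinite (Quot fun d e : D => e = r d ∨ e = ε d)
  rw [hker, h2, finrank_fintype_fun_eq_card, finrank_fintype_fun_eq_card,
    ← Nat.card_eq_fintype_card, ← Nat.card_eq_fintype_card] at h1
  exact h1

end Cochains

theorem sum_edges [Fintype T.D] [Fintype T.Edges] (u : T.D → ZMod 2) (h : T.Edges → ZMod 2)
    (hu : ∀ d, h (Quot.mk _ d) = u d + u (T.edge d)) : ∑ e, h e = ∑ d, u d := by
  classical
  rw [← Finset.sum_fiberwise (s := Finset.univ) (g := fun d => (Quot.mk _ d : T.Edges))]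
  refine Finset.sum_congr rfl fun e _ => ?_
  obtain ⟨d, rfl⟩ := Quot.exists_rep e
  have key : ∀ d', (Quot.mk _ d' : T.Edges) = Quot.mk _ d → d' = d ∨ d' = T.edge d := by
    intro d' hd
    have := congrArg (Quot.lift (fun e => ({e, T.edge e} : Set T.D)) (by
      rintro a _ rfl
      rw [T.edge_edge, Set.pair_comm])) hd
    change ({d', T.edge d'} : Set T.D) = {d, T.edge d} at this
    have hm : d' ∈ ({d, T.edge d} : Set T.D) := this ▸ Set.mem_insert _ _
    exact hm
  have hf : (Finset.univ.filter fun d' => (Quot.mk _ d' : T.Edges) = Quot.mk _ d) =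
      {d, T.edge d} := by
    ext d'
    simp only [Finset.mem_filter, Finset.mem_univ, true_and, Finset.mem_insert,
      Finset.mem_singleton]
    refine ⟨key d', ?_⟩
    rintro (rfl | rfl)
    · rfl
    · symm; exact Quot.sound rfl
  rw [hf, Finset.sum_pair (T.edge_ne d).symm, hu]

/-- The darts of a planar diagram can be coloured such that both adjacent darts at a vertex and the
two darts of an edge get different colours.  Equivalently, the faces have a checkerboard colouring:
by Euler's formula, the coboundaries of functions on the faces and on the vertices are
orthogonal complements, and the constant function `1` is orthogonal to the latter since
all vertices have even degree. -/
theorem IsPlanar.exists_alternating (hT : T.IsPlanar) :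
    ∃ c : T.D → Bool, (∀ d, c (rot d) = !c d) ∧ ∀ d, c (T.edge d) = !c d := by
  classical
  let := Fintype.ofFinite T.D
  let := Fintype.ofFinite T.Edges
  let φ : T.D → T.D := fun d => rot (T.edge d)
  let MV := coboundary (rot : T.D → T.D) T.edge T.edge_edge
  let MF := coboundary φ T.edge T.edge_edge
  have hV := finrank_range_coboundary (rot : T.D → T.D) T.edge T.edge_edge
  have hF := finrank_range_coboundary φ T.edge T.edge_edge
  have hP : Nat.card (Quot fun d e : T.D => e = φ d ∨ e = T.edge d) = Nat.card T.Pieces := by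
    let m : T.D → T.Pieces := Quot.mk _
    have m_rot : ∀ d, m (rot d) = m d := fun d => by symm; exact Quot.sound (Or.inl rfl)
    have m_edge : ∀ d, m (T.edge d) = m d := fun d => by symm; exact Quot.sound (Or.inr rfl)
    let g : T.D → Quot fun d e : T.D => e = φ d ∨ e = T.edge d := Quot.mk _
    have g_edge : ∀ d, g (T.edge d) = g d := fun d => by symm; exact Quot.sound (Or.inr rfl)
    have g_rot : ∀ d, g (rot d) = g d := fun d => by
      have : g (φ (T.edge d)) = g (T.edge d) := by symm; exact Quot.sound (Or.inl rfl)
      rw [g_edge] at this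
      simp only [φ, T.edge_edge] at this
      exact this
    refine Nat.card_congr
      { toFun := Quot.lift m ?_, invFun := Quot.lift g ?_, left_inv := ?_, right_inv := ?_ }
    · rintro d _ (rfl | rfl)
      · exact ((m_rot _).trans (m_edge d)).symm
      · exact (m_edge d).symm
    · rintro d _ (rfl | rfl)
      · exact (g_rot d).symm
      · exact (g_edge d).symm
    · rintro ⟨d⟩; rfl
    · rintro ⟨d⟩; rfl
  have hrot_bij : Function.Bijective (rot : T.D → T.D) := by
    refine Finite.injective_iff_bijective.1 ?_
    rintro (⟨x, s⟩ | ⟨p, b⟩ | i) (⟨y, t⟩ | ⟨q, b'⟩ | j) h <;> simp_all [rot]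
  -- the bilinear pairing on functions on the edges
  let Φ := dotProductEquiv (ZMod 2) T.Edges
  let W : Submodule (ZMod 2) (T.Edges → ZMod 2) :=
    (LinearMap.range MV).dualAnnihilator.comap Φ.toLinearMap
  have hW : ∀ g, g ∈ W ↔ ∀ f, ∑ e, g e * MV f e = 0 := by
    intro g
    rw [Submodule.mem_comap, Submodule.mem_dualAnnihilator]
    constructor
    · exact fun h f => h _ ⟨f, rfl⟩
    · rintro h _ ⟨f, rfl⟩
      exact h f
  have hWrank : finrank (ZMod 2) (LinearMap.range MV) + finrank (ZMod 2) W = Nat.card T.Edges := by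
    have h1 := Subspace.finrank_add_finrank_dualAnnihilator_eq (LinearMap.range MV)
    have h2 : finrank (ZMod 2) W = finrank (ZMod 2) (LinearMap.range MV).dualAnnihilator :=
      LinearEquiv.finrank_eq (Φ.ofSubmodule' _)
    rw [h2, h1, finrank_fintype_fun_eq_card, Nat.card_eq_fintype_card]
  have hle : LinearMap.range MF ≤ W := by
    rintro _ ⟨g, rfl⟩
    rw [hW]
    intro f
    let v : T.D → ZMod 2 := fun d => f (Quot.mk _ d)
    let w : T.D → ZMod 2 := fun d => g (Quot.mk _ d)
    have hv : ∀ d, v (rot d) = v d := fun d => congrArg f (by symm; exact Quot.sound rfl)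
    have hw : ∀ d, w (T.edge d) = w (rot d) := fun d => by
      have : w (φ (T.edge d)) = w (T.edge d) := congrArg g (by symm; exact Quot.sound rfl)
      rw [← this]
      simp only [φ, T.edge_edge]
    rw [sum_edges (fun d => v d * (w d + w (T.edge d)))]
    · simp only [mul_add, Finset.sum_add_distrib]
      have : ∑ d, v d * w (T.edge d) = ∑ d, v d * w d := by
        rw [← (Equiv.ofBijective _ hrot_bij).sum_comp fun d => v d * w d]
        refine Finset.sum_congr rfl fun d _ => ?_
        change _ = v (rot d) * w (rot d)
        rw [hv, hw]
      rw [this]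
      exact CharTwo.add_self_eq_zero _
    · intro d
      change (w d + w (T.edge d)) * (v d + v (T.edge d)) = _
      rw [T.edge_edge]
      ring
  have hrange : LinearMap.range MF = W := by
    refine Submodule.eq_of_le_of_finrank_eq hle ?_
    have hT' : Nat.card T.Vertices + Nat.card T.Faces =
      Nat.card T.Edges + 2 * Nat.card T.Pieces := hT
    have hF' : finrank (ZMod 2) (LinearMap.range MF) + Nat.card T.Pieces = Nat.card T.Faces :=
      hP ▸ hF
    have hV' : finrank (ZMod 2) (LinearMap.range MV) + Nat.card T.Pieces = Nat.card T.Vertices := hV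
    have key : ∀ a b c v f e p : ℕ, v + f = e + 2 * p → a + p = f → b + p = v → b + c = e →
        a = c := by omega
    exact key _ _ _ _ _ _ _ hT' hF' hV' hWrank
  have hone : (1 : T.Edges → ZMod 2) ∈ W := by
    rw [hW]
    intro f
    let v : T.D → ZMod 2 := fun d => f (Quot.mk _ d)
    have hv : ∀ d, v (rot d) = v d := fun d => congrArg f (by symm; exact Quot.sound rfl)
    rw [sum_edges v _ fun d => one_mul _]
    let := Fintype.ofFinite T.X
    let := Fintype.ofFinite T.P
    rw [← (equivSum T.X T.P 0).sum_comp, Fintype.sum_sum_type, Fintype.sum_sum_type,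
      Fintype.sum_prod_type, Fintype.sum_prod_type, Finset.univ_eq_empty (α := Fin 0),
      Finset.sum_empty, add_zero]
    have h1 : ∀ x : T.X, ∑ c : Fin 4, v (equivSum T.X T.P 0 (Sum.inl (x, c))) = 0 := by
      intro x
      have h0 : v (cross x 1) = v (cross x 0) := hv (cross x 0)
      have h2 : v (cross x 3) = v (cross x 2) := hv (cross x 2)
      rw [Fin.sum_univ_four]
      change v (cross x 0) + v (cross x 1) + v (cross x 2) + v (cross x 3) = 0
      rw [h0, h2, CharTwo.add_self_eq_zero, zero_add, CharTwo.add_self_eq_zero]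
    have h2 : ∀ p : T.P, ∑ b : Bool, v (equivSum T.X T.P 0 (Sum.inr (Sum.inl (p, b)))) = 0 := by
      intro p
      have h0 : v (mark p true) = v (mark p false) := hv (mark p false)
      rw [Fintype.sum_bool]
      change v (mark p true) + v (mark p false) = 0
      rw [h0, CharTwo.add_self_eq_zero]
    simp only [h1, h2, Finset.sum_const_zero, add_zero]
  rw [← hrange] at hone
  obtain ⟨g, hg⟩ := hone
  let w : T.D → ZMod 2 := fun d => g (Quot.mk _ d)
  have hw : ∀ d, w d + w (T.edge d) = 1 := fun d => congrFun hg (Quot.mk _ d)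
  have hw' : ∀ d, w (T.edge d) = w (rot d) := fun d => by
    have : w (φ (T.edge d)) = w (T.edge d) := congrArg g (by symm; exact Quot.sound rfl)
    rw [← this]
    simp only [φ, T.edge_edge]
  have hflip : ∀ x y : ZMod 2, x + y = 1 → decide (y = 1) = !decide (x = 1) := by decide
  refine ⟨fun d => decide (w d = 1), fun d => hflip _ _ ?_, fun d => hflip _ _ (hw d)⟩
  rw [← hw', hw]

/-- An alternating colouring is compatible with every smoothing. -/
theorem alternating_smoothing {c : T.D → Bool} (hc : ∀ d, c (rot d) = !c d) (s : T.X → Bool)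
    (d : T.D) : c (reconnect (smoothing s) d) = !c d := by
  rcases d with ⟨x, e⟩ | ⟨p, b⟩ | i
  · have key : ∀ o : Fin 4 → Bool, (∀ e, o (e + 1) = !o e) →
        ∀ (b : Bool) (e : Fin 4), o ((if b then 1 else 3) - e) = !o e := by decide
    exact key (fun e => c (cross x e)) (fun e => hc (cross x e)) (s x) e
  · exact hc (mark p b)
  · exact i.elim0

end Tangle

/-! ### The Jones polynomial of a knot under a change of the root of unity -/

namespace Tangle

variable {T : Tangle 0} {R : Type*} [CommRing R] {A B ζ : R}

theorem exists_isOrientation (T : Tangle 0) : ∃ o, T.IsOrientation o := by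
  have ha : Function.Involutive (straight : T.D → T.D) := by
    rw [straight_eq_reconnect_pairing]
    exact reconnect_involutive _
  have ha' : ∀ d : T.D, straight d ≠ d := by
    rintro (⟨x, c⟩ | ⟨p, b⟩ | i) h
    · exact (by decide : ∀ c : Fin 4, c + 2 ≠ c) c (Dart.cross.inj h).2
    · exact Bool.not_ne_self b (Dart.mark.inj h).2
    · exact i.elim0
  obtain ⟨o, h1, h2⟩ := exists_flip_of_involutive ha T.edge_edge ha' T.edge_ne
  exact ⟨o, fun x c => h1 (cross x c), fun p b => h1 (mark p b), h2⟩

theorem IsOrientation.straight {o : T.D → Bool} (ho : T.IsOrientation o) (d : T.D) :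
    o d.straight = !o d := by
  rcases d with ⟨x, c⟩ | ⟨p, b⟩ | i
  · exact ho.cross x c
  · exact ho.mark p b
  · exact i.elim0

/-- The Jones polynomial of a knot does not depend on its orientation. -/
theorem IsOrientation.jones_eq {o o' : T.D → Bool} (ho : T.IsOrientation o)
    (ho' : T.IsOrientation o') (hT : Nat.card T.Strands = 1) (A B : R) :
    T.jones o A B = T.jones o' A B := by
  let f : T.Strands → Bool := Quot.lift (fun d => o d ^^ o' d) (by
    rintro d _ (rfl | rfl)
    · rw [ho.straight, ho'.straight]; simp
    · rw [ho.edge, ho'.edge]; simp)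
  have := (Nat.card_eq_one_iff_unique.1 hT).1
  have hf : ∀ d e : T.D, (o d ^^ o' d) = (o e ^^ o' e) := fun d e =>
    congrArg f (Subsingleton.elim (Quot.mk _ d) (Quot.mk _ e))
  unfold jones writheFactor
  congr 1
  refine Finset.prod_congr rfl fun x _ => if_congr ?_ rfl rfl
  have := hf (Dart.cross x 1) (Dart.cross x 2)
  revert this
  cases o (Dart.cross x 1) <;> cases o (Dart.cross x 2) <;> cases o' (Dart.cross x 1) <;>
    cases o' (Dart.cross x 2) <;> simp

/-- In a planar diagram of a knot, all Kauffman states have the same sign, if the number of loops,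
the number of smoothings of weight `B` and the numbers of all crossings and of all negative
crossings are taken into account. -/
theorem IsOrientation.state_sign [Fintype T.X] {o : T.D → Bool} (ho : T.IsOrientation o)
    (hP : T.IsPlanar) (hT : Nat.card T.Strands = 1) (s : T.X → Bool) :
    (-1 : ℤ) ^ Nat.card (T.Loops (smoothing s)) * (∏ x, if s x then 1 else -1) *
      (∏ x : T.X, if o (Dart.cross x 1) = o (Dart.cross x 2) then 1 else -1) * ∏ _x : T.X, (-1) =
        -1 := by
  obtain ⟨c, hc, hce⟩ := hP.exists_alternating
  -- the smoothing of all crossings that respects the orientation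
  let s₀ : T.X → Bool := fun x => decide (o (Dart.cross x 1) = o (Dart.cross x 2))
  have h0 : ∀ d, o (reconnect (smoothing s₀) d) = !o d := by
    rintro (⟨x, e⟩ | ⟨p, b⟩ | i)
    · have key : ∀ o : Fin 4 → Bool, (∀ e, o (e + 2) = !o e) →
          ∀ e : Fin 4, o ((if decide (o 1 = o 2) then 1 else 3) - e) = !o e := by decide
      exact key (fun e => o (Dart.cross x e)) (fun e => ho.cross x e) e
    · exact ho.mark p b
    · exact i.elim0
  have hstr : ∀ d : T.D, o (reconnect (fun _ => pairing 0) d) = !o d := fun d => by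
    rw [← straight_eq_reconnect_pairing]; exact ho.straight d
  have h1 := neg_one_pow_loops ho.edge (fun _ => 0) (fun x => if s₀ x then 1 else 2) hstr
    (by rw [← smoothing_eq_pairing]; exact h0)
  have h2 := neg_one_pow_loops hce (fun x => if s₀ x then 1 else 2) (fun x => if s x then 1 else 2)
    (by rw [← smoothing_eq_pairing]; exact alternating_smoothing hc s₀)
    (by rw [← smoothing_eq_pairing]; exact alternating_smoothing hc s)
  have hone : Nat.card (T.Loops fun _ => pairing 0) = 1 := by
    have : Nat.card T.Strands = Nat.card (T.Loops fun _ => pairing 0) := by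
      unfold Strands Loops
      rw [straight_eq_reconnect_pairing]
    rw [← this, hT]
  rw [← smoothing_eq_pairing] at h1 h2
  rw [← smoothing_eq_pairing] at h2
  rw [h2, h1, hone]
  simp only [mul_assoc, ← Finset.prod_mul_distrib]
  rw [pow_one, Finset.prod_congr rfl (g := fun _ => 1), Finset.prod_const_one, mul_one]
  intro x _
  by_cases hx : o (Dart.cross x 1) = o (Dart.cross x 2) <;> cases s x <;> simp [s₀, hx]

/-- For a knot, the bracket normalized by the writhe lies in `A ^ 2 * ℤ[A ^ 4, A ^ (-4)]`: it
changes its sign if `A` is multiplied by a square root `ζ` of `-1`. -/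
theorem IsOrientation.jones_fourth_root {o : T.D → Bool} (ho : T.IsOrientation o)
    (hP : T.IsPlanar) (hT : Nat.card T.Strands = 1) (hζ : ζ ^ 2 = -1) :
    T.jones o (ζ * A) (-(ζ * B)) = -T.jones o A B := by
  classical
  let := Fintype.ofFinite T.X
  have hw : T.writheFactor o (ζ * A) (-(ζ * B)) = T.writheFactor o A B *
      ((∏ _x : T.X, ζ) *
        ∏ x : T.X, if o (Dart.cross x 1) = o (Dart.cross x 2) then 1 else -1) := by
    rw [writheFactor_eq_prod, writheFactor_eq_prod, ← Finset.prod_mul_distrib,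
      ← Finset.prod_mul_distrib]
    refine Finset.prod_congr rfl fun x _ => ?_
    split_ifs
    · linear_combination ζ * B ^ 3 * hζ
    · linear_combination -ζ * A ^ 3 * hζ
  unfold jones
  rw [hw, bracket_eq_sum, bracket_eq_sum, Finset.mul_sum, Finset.mul_sum, ← Finset.sum_neg_distrib]
  refine Finset.sum_congr rfl fun s _ => ?_
  have hs : stateWeight (ζ * A) (-(ζ * B)) s = stateWeight A B s *
      ((∏ _x : T.X, ζ) * ∏ x, if s x then 1 else -1) := by
    unfold stateWeight
    rw [← Finset.prod_mul_distrib, ← Finset.prod_mul_distrib]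
    refine Finset.prod_congr rfl fun x _ => ?_
    split_ifs <;> ring
  have hδ : -(ζ * A) ^ 2 - (-(ζ * B)) ^ 2 = -1 * (-A ^ 2 - B ^ 2) := by
    linear_combination (-A ^ 2 - B ^ 2) * hζ
  have hsign := congrArg (Int.cast : ℤ → R) (ho.state_sign hP hT s)
  push_cast at hsign
  have hζζ : (∏ _x : T.X, ζ) * (∏ _x : T.X, ζ) = ∏ _x : T.X, (-1) := by
    rw [← Finset.prod_mul_distrib]
    exact Finset.prod_congr rfl fun _ _ => by rw [← sq, hζ]
  rw [hs, hδ, mul_pow]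
  rw [← hζζ] at hsign
  linear_combination T.writheFactor o A B * stateWeight A B s *
    (-A ^ 2 - B ^ 2) ^ Nat.card (T.Loops (smoothing s)) * hsign

end Tangle

namespace LinkDiagram

/-! ### Chirality -/

variable {F : Type*} [Field F]

theorem exists_writheFactor_eq_pow (T : Tangle 0) (o : T.D → Bool) :
    ∃ l : ℕ, ∀ A B : F, A * B = 1 → A ^ 8 - A ^ 4 + 1 = 0 →
      T.writheFactor o A B = A ^ (3 * l) := by
  let := Fintype.ofFinite T.X
  refine ⟨∑ x : T.X, if o (cross x 1) = o (cross x 2) then 3 else 5, fun A B h hA => ?_⟩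
  rw [T.writheFactor_eq_prod, Finset.mul_sum, ← Finset.prod_pow_eq_pow_sum]
  refine Finset.prod_congr rfl fun x _ => ?_
  rw [neg_cube hA, neg_inv_cube h hA]
  split_ifs <;> rfl

theorem sq_loop_value {A B : F} (h : A * B = 1) (hA : A ^ 8 - A ^ 4 + 1 = 0) :
    (-A ^ 2 - B ^ 2) ^ 2 = 3 := by
  have h4 : A ^ 4 * B ^ 4 = 1 := by rw [← mul_pow, h, one_pow]
  have h2 : A ^ 2 * B ^ 2 = 1 := by rw [← mul_pow, h, one_pow]
  linear_combination B ^ 4 * hA + (1 - A ^ 4) * h4 + 2 * h2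

/-- Over a field with a primitive 24-th root of unity, an amphichiral knot is not 3-equivalent to
an unlink with an even number of components. -/
theorem isChiral_of_root {A : F} (hA : A ^ 8 - A ^ 4 + 1 = 0) (h2 : (2 : F) ≠ 0) (h3 : (3 : F) ≠ 0)
    (K : LinkDiagram) (hK : K.IsKnot) (m : ℕ) (h : ThreeEquivalent K (unlink (m + m))) :
    K.IsChiral := by
  intro hiso
  have hA0 : A ≠ 0 := by
    rintro rfl
    norm_num at hA
  obtain ⟨j, hj⟩ := bracketAssociated_of_threeEquivalent (R := F) h
  obtain ⟨o, ho⟩ := K.toTangle.exists_isOrientation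
  obtain ⟨l, hl⟩ := exists_writheFactor_eq_pow (F := F) K.toTangle o
  -- the Jones polynomial of `K` at a primitive 24-th root of unity
  have hval : ∀ A B : F, A * B = 1 → A ^ 8 - A ^ 4 + 1 = 0 →
      K.toTangle.jones o A B = A ^ (3 * (l + j)) * 3 ^ m := by
    intro A B hAB hA
    have hc : (unlink (m + m)).toTangle.bracket A B = 3 ^ m := by
      refine (Tangle.bracket_circles (m + m)).trans ?_
      rw [← two_mul, pow_mul, sq_loop_value hAB hA]
    rw [Tangle.jones, hl A B hAB hA, hj A B hAB hA, hc, mul_add, pow_add, mul_assoc]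
  -- it takes the same value at the inverse root of unity
  have hmirror : ∀ A B : F, A * B = 1 → K.toTangle.jones o A B = K.toTangle.jones o B A := by
    intro A B hAB
    obtain ⟨o', ho', h'⟩ := (jonesLE_of_isotopic (R := F) hiso).1 o ho
    rw [h' A B hAB]
    exact ho'.jones_mirror.trans (ho'.of_mirror.jones_eq ho hK B A)
  obtain ⟨B, hAB⟩ : ∃ B, A * B = 1 := ⟨A⁻¹, mul_inv_cancel₀ hA0⟩
  have h12 : A ^ 12 = -1 := pow_twelve hA
  have h24 : A ^ 24 = 1 := pow_twentyFour hA
  have hB : B ^ 8 - B ^ 4 + 1 = 0 := by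
    have h8 : A ^ 8 * B ^ 8 = 1 := by rw [← mul_pow, hAB, one_pow]
    have h4 : A ^ 4 * B ^ 4 = 1 := by rw [← mul_pow, hAB, one_pow]
    linear_combination B ^ 8 * hA + (B ^ 4) * h4 - h8
  have hm : (3 : F) ^ m ≠ 0 := pow_ne_zero _ h3
  set k := l + j
  have hk : A ^ (6 * k) = 1 := by
    have h1 := hmirror A B hAB
    rw [hval A B hAB hA, hval B A (by rw [mul_comm, hAB]) hB] at h1
    have h1 := mul_right_cancel₀ hm h1
    have h3 : A ^ (3 * k) * B ^ (3 * k) = 1 := by rw [← mul_pow, hAB, one_pow]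
    rw [show 6 * k = 3 * k + 3 * k by ring, pow_add]
    nth_rewrite 2 [h1]
    exact h3
  have hneg : (-1 : F) ≠ 1 := fun h => h2 (by linear_combination -h)
  -- hence `A ^ (3 * k)` is a power of `A ^ 12 = -1`
  obtain ⟨r, hr⟩ : 4 ∣ k := by
    have hmod : A ^ (6 * (k % 4)) = 1 := by
      rw [← hk]
      nth_rewrite 2 [← Nat.div_add_mod k 4]
      rw [mul_add, ← mul_assoc, pow_add, pow_mul A (6 * 4), h24, one_pow, one_mul]
    refine Nat.dvd_of_mod_eq_zero ?_
    have hlt : k % 4 < 4 := Nat.mod_lt _ (by norm_num)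
    generalize k % 4 = t at hmod hlt
    interval_cases t
    · rfl
    · exact absurd (by linear_combination -h12 + (A ^ 6 + 1) * hmod) hneg
    · exact absurd (by linear_combination -h12 + hmod) hneg
    · exact absurd (by linear_combination -h12 - A ^ 12 * h24 + (A ^ 18 + 1) * hmod) hneg
  have hζ : (A ^ 6) ^ 2 = -1 := by rw [← pow_mul]; exact h12
  -- passing to the root of unity `A ^ 7` changes the sign, although the value is the same
  have h7 : K.toTangle.jones o (A ^ 6 * A) (-(A ^ 6 * B)) = A ^ (3 * k) * 3 ^ m := by
    rw [hval _ _ (by linear_combination -A ^ 12 * hAB - h12)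
      (by linear_combination hA + (A ^ 8 * (A ^ 24 + 1) - A ^ 4) * h24), hr]
    congr 1
    rw [← pow_succ, ← pow_mul, show (6 + 1) * (3 * (4 * r)) = 24 * (3 * r) + 3 * (4 * r) by ring,
      pow_add, pow_mul A 24, h24, one_pow, one_mul]
  rw [ho.jones_fourth_root K.planar hK hζ, hval A B hAB hA] at h7
  have hne : A ^ (3 * k) * 3 ^ m ≠ 0 := mul_ne_zero (pow_ne_zero _ hA0) hm
  exact mul_ne_zero h2 hne (by linear_combination -h7)

end LinkDiagram

theorem corollary3p4 (K : LinkDiagram) (hK : K.IsKnot) (n : ℕ) (hn : Even n)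
    (h : LinkDiagram.ThreeEquivalent K (LinkDiagram.unlink n)) : K.IsChiral := by
  obtain ⟨m, rfl⟩ := hn
  -- `52` is a primitive 24-th root of unity modulo `73`
  have hA : (52 : ZMod 73) ^ 8 - 52 ^ 4 + 1 = 0 := by decide
  have h2 : (2 : ZMod 73) ≠ 0 := by decide
  have h3 : (3 : ZMod 73) ≠ 0 := by decide
  have : Fact (Nat.Prime 73) := ⟨by norm_num⟩
  exact LinkDiagram.isChiral_of_root hA h2 h3 K hK m h
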